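/- For $r\ge 3$, let $WB(r)$ denote the $r$-dimensional wrapped butterfly: its vertices are the pairs $(i,w)$ with a level $0\le i\le r-1$ and an $r$-bit word $w=(w_0,\dots,w_{r-1})$ (the row), and the vertices $(i,w)$ and $(i+1 \bmod r,\,w')$ are joined by an edge exactly when $w=w'$ or $w$ and $w'$ differ in precisely the bit with index $i$. A drawing of a graph in the plane is good if no edge crosses itself, no two adjacent edges cross, no two edges cross more than once, and no three edges cross in a point; the crossing number $Cr(G)$ is the minimum number of edge crossings in a good drawing of $G$ in the plane. Then for every integer $r\ge 6$, $$Cr(WB(r))\;\le\;\tfrac{7}{8}\,4^{r}-(3r-4)\,2^{r}.$$ -/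

import Mathlib

/-- The `r`-dimensional wrapped butterfly `WB(r)`.  A vertex is a pair (level `i`, row `w`) with
`0 ≤ i ≤ r - 1` and `w` an `r`-bit word.  Level `i` is joined to level `i + 1` (modulo `r`, as
level `r` is merged with level `0`), and the rows of two linked vertices are identical or differ
in precisely the bit with index `i`. -/
def wrappedButterfly (r : ℕ) : SimpleGraph (Fin r × (Fin r → Bool)) :=
  SimpleGraph.fromRel fun u v =>
    (v.1 : ℕ) = ((u.1 : ℕ) + 1) % r ∧
      (u.2 = v.2 ∨ ∀ b : Fin r, u.2 b ≠ v.2 b ↔ b = u.1)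

namespace SimpleGraph

variable {V : Type*}

/-- A drawing of `G` in the plane: distinct points for the vertices and, for each edge, a
continuous curve that joins the points of its two ends and meets no vertex point in between. -/
structure PlaneDrawing (G : SimpleGraph V) where
  /-- the point that represents a vertex -/
  point : V → ℝ × ℝ
  point_injective : Function.Injective point
  /-- the curve that represents an edge -/
  curve : G.edgeSet → C(unitInterval, ℝ × ℝ)
  /-- the two ends of the curve are the points of the two ends of the edge, in either order -/
  curve_ends : ∀ e : G.edgeSet, s(curve e 0, curve e 1) = Sym2.map point (e : Sym2 V)
  curve_avoids : ∀ (e : G.edgeSet) (v : V) (t : unitInterval), 0 < t → t < 1 →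
    curve e t ≠ point v

namespace PlaneDrawing

variable {G : SimpleGraph V}

/-- The points at which the curves of `e` and `f` cross: the common interior points of the two
curves.  (Points where the curves merely touch are counted too.) -/
def crossingsOf (D : G.PlaneDrawing) (e f : G.edgeSet) : Set (ℝ × ℝ) :=
  D.curve e '' Set.Ioo 0 1 ∩ D.curve f '' Set.Ioo 0 1

/-- A good drawing: no edge crosses itself, no two adjacent edges cross, no two edges cross more
than once, and no three edges cross in a point. -/
structure IsGood (D : G.PlaneDrawing) : Prop where
  not_self_crossing : ∀ e : G.edgeSet, Function.Injective (D.curve e)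
  adjacent_not_crossing : ∀ e f : G.edgeSet, e ≠ f →
    (∃ v : V, v ∈ (e : Sym2 V) ∧ v ∈ (f : Sym2 V)) → D.crossingsOf e f = ∅
  crossing_once : ∀ e f : G.edgeSet, e ≠ f → (D.crossingsOf e f).Subsingleton
  no_triple_crossing : ∀ e f g : G.edgeSet, e ≠ f → f ≠ g → e ≠ g →
    D.crossingsOf e f ∩ D.crossingsOf e g = ∅

/-- All points of the plane at which two distinct edges cross. -/
def crossings (D : G.PlaneDrawing) : Set (ℝ × ℝ) :=
  {p | ∃ e f : G.edgeSet, e ≠ f ∧ p ∈ D.crossingsOf e f}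

end PlaneDrawing

/-- The crossing number of `G`: the least number of crossings in a good drawing of `G` in the
plane (`⊤` if there is no good drawing with finitely many crossings). -/
noncomputable def crossingNumber (G : SimpleGraph V) : ℕ∞ :=
  ⨅ (D : G.PlaneDrawing) (_ : D.IsGood), D.crossings.encard

end SimpleGraph

/-! Put the vertices on a line and draw each edge as an arc above or below it. If all arcs on a side
are parabolas of the same curvature, two of them cross at most once, and only if their ends
interleave. If the vertices are spaced sparsely enough, no three arcs are concurrent. The drawing is
then good, and bounding the crossing number becomes counting interleaving pairs in a two-page layout
(`SimpleGraph.BookDrawing.crossingNumber_le`).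

Layouts are built by doubling. Appending a bit to the rows replaces each vertex by two copies inside
a block of four positions, and each edge by two nested arcs. A crossing pair yields at most four
crossings. A touching pair, that is, two arcs on one page sharing an end, yields at most one
crossing and at most two touching pairs. The blocks of level `0` also receive the copies at the new
level `r`, joined to those at level `0` by four short arcs per block. Hence, with `c` crossings and
`t` touching pairs, c' ≤ 4c + t + 2·2^r and t' ≤ 2t + 12·2^r (`crossings_double_le`,
`touchings_double_le`). An explicit layout of dimension 4 with c = 83 and t = 150 starts the
recursion, whose solution lies below the required bound. -/

/-! ### Sparse points and the nonvanishing of the concurrency determinant -/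

/-- A rapidly growing sequence of positions on a line. -/
def sparsePoint (n : ℕ) : ℤ := 4 ^ 4 ^ n

lemma one_le_sparsePoint (n : ℕ) : 1 ≤ sparsePoint n :=
  one_le_pow₀ (by norm_num)

lemma sparsePoint_strictMono : StrictMono sparsePoint := fun _ _ h =>
  pow_lt_pow_right₀ (by norm_num) (Nat.pow_lt_pow_right (by norm_num) h)

lemma sparsePoint_succ (n : ℕ) : 3 * sparsePoint n ^ 3 < sparsePoint (n + 1) := by
  have h : sparsePoint (n + 1) = sparsePoint n * sparsePoint n ^ 3 := by
    simp only [sparsePoint, ← pow_mul, ← pow_add]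
    congr 1
    ring
  have h4 : 4 ≤ sparsePoint n := by
    calc (4 : ℤ) = 4 ^ 1 := by norm_num
      _ ≤ 4 ^ 4 ^ n := pow_le_pow_right₀ (by norm_num) (Nat.one_le_pow _ _ (by norm_num))
  have : 0 < sparsePoint n ^ 3 := by positivity
  rw [h]
  nlinarith

/-- A common bound for the members of the sequence below a given index. -/
lemma exists_sparsePoint_bound {b : ℕ} (hb : 0 < b) :
    ∃ M : ℤ, 1 ≤ M ∧ 3 * M ^ 3 < sparsePoint b ∧ ∀ a < b, sparsePoint a ≤ M := by
  obtain ⟨k, rfl⟩ := Nat.exists_eq_succ_of_ne_zero hb.ne'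
  exact ⟨sparsePoint k, one_le_sparsePoint k, sparsePoint_succ k, fun a ha =>
    sparsePoint_strictMono.monotone (Nat.lt_succ_iff.mp ha)⟩

/-- A linear form with nonzero integral leading coefficient does not vanish far out. -/
lemma mul_add_ne_zero_of_lt {z k c C : ℤ} (hk : k ≠ 0) (hc : |c| ≤ C) (hz : C < z) :
    z * k + c ≠ 0 := by
  intro h
  have hz0 : 0 < z := (abs_nonneg c).trans_lt (hc.trans_lt hz)
  have h1 : |c| = z * |k| := by
    rw [show c = -(z * k) by linarith, abs_neg, abs_mul, abs_of_pos hz0]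
  have : 1 ≤ |k| := Int.one_le_abs hk
  nlinarith

lemma sparsePoint_add_ne {a b c d : ℕ} (hab : a < b) (hcd : c < d) (hbd : b ≠ d) :
    sparsePoint a + sparsePoint b - (sparsePoint c + sparsePoint d) ≠ 0 := by
  wlog h : d < b generalizing a b c d
  · intro h0
    exact this hcd hab hbd.symm (by omega) (by linarith)
  obtain ⟨M, hM, hMb, hle⟩ := exists_sparsePoint_bound (Nat.zero_lt_of_lt hab)
  have := hle c (by omega)
  have := hle d (by omega)
  have := one_le_sparsePoint a
  have : M ≤ M ^ 3 := le_self_pow₀ hM (by norm_num)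
  intro h0
  linarith

/-- Writing s for `sparsePoint`, the expression is (s_a - s_q)(s_b - s_q) - (s_c - s_q)(s_d - s_q).
After arranging d < b, it is linear in the largest point: the coefficient of s_q is, up to sign, the
form in `sparsePoint_add_ne`, and that of s_b is s_a - s_q. -/
lemma sparsePoint_quadratic_ne {a b c d q : ℕ} (hab : a < b) (hcd : c < d) (hbd : b ≠ d)
    (haq : a ≠ q) (hbq : b ≠ q) (hcq : c ≠ q) (hdq : d ≠ q) :
    sparsePoint a * sparsePoint b - sparsePoint c * sparsePoint d -
      sparsePoint q * (sparsePoint a + sparsePoint b - (sparsePoint c + sparsePoint d)) ≠ 0 := by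
  wlog h : d < b generalizing a b c d
  · intro h0
    exact this hcd hab hbd.symm hcq hdq haq hbq (by omega) (by linarith)
  have hpos := one_le_sparsePoint
  rcases lt_or_gt_of_ne hbq with hq | hq
  · obtain ⟨M, hM, hMb, hle⟩ := exists_sparsePoint_bound (Nat.zero_lt_of_lt hq)
    have ha := hle a (by omega)
    have hb := hle b (by omega)
    have hc := hle c (by omega)
    have hd := hle d (by omega)
    have h1 := mul_add_ne_zero_of_lt (z := sparsePoint q) (C := 3 * M ^ 3)
      (c := -(sparsePoint a * sparsePoint b - sparsePoint c * sparsePoint d))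
      (sparsePoint_add_ne hab hcd hbd) ?_ hMb
    · contrapose! h1
      linarith
    · have h1 : sparsePoint a * sparsePoint b ≤ M * M :=
        mul_le_mul ha hb (by linarith [hpos b]) (by linarith)
      have h2 : sparsePoint c * sparsePoint d ≤ M * M :=
        mul_le_mul hc hd (by linarith [hpos d]) (by linarith)
      have h3 : M * M ≤ M ^ 3 := by nlinarith [mul_pos (show 0 < M by linarith) (show 0 < M by linarith)]
      have h4 : 0 < sparsePoint a * sparsePoint b := mul_pos (by linarith [hpos a]) (by linarith [hpos b])
      have h5 : 0 < sparsePoint c * sparsePoint d := mul_pos (by linarith [hpos c]) (by linarith [hpos d])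
      rw [abs_le]
      constructor <;> nlinarith
  · obtain ⟨M, hM, hMb, hle⟩ := exists_sparsePoint_bound (Nat.zero_lt_of_lt hq)
    have ha := hle a (by omega)
    have hq' := hle q (by omega)
    have hc := hle c (by omega)
    have hd := hle d (by omega)
    have hk : sparsePoint a - sparsePoint q ≠ 0 :=
      sub_ne_zero.mpr (sparsePoint_strictMono.injective.ne haq)
    have h1 := mul_add_ne_zero_of_lt (z := sparsePoint b) (C := 3 * M ^ 3)
      (c := -(sparsePoint c * sparsePoint d) - sparsePoint q * sparsePoint a +
        sparsePoint q * sparsePoint c + sparsePoint q * sparsePoint d) hk ?_ hMb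
    · contrapose! h1
      linarith
    · have bd : ∀ x y : ℕ, sparsePoint x ≤ M → sparsePoint y ≤ M →
          0 < sparsePoint x * sparsePoint y ∧ sparsePoint x * sparsePoint y ≤ M * M := fun x y hx hy =>
        ⟨mul_pos (by linarith [hpos x]) (by linarith [hpos y]),
          mul_le_mul hx hy (by linarith [hpos y]) (by linarith)⟩
      have h3 : M * M ≤ M ^ 3 := by nlinarith [mul_pos (show 0 < M by linarith) (show 0 < M by linarith)]
      have h4 := bd c d hc hd
      have h5 := bd q a hq' ha
      have h6 := bd q c hq' hc
      have h7 := bd q d hq' hd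
      rw [abs_le]
      constructor <;> linarith [h4.1, h4.2, h5.1, h5.2, h6.1, h6.2, h7.1, h7.2]

/-- The determinant vanishes when the parabolas over the three segments are concurrent. Once s_b is
made the largest point, its square cancels and its coefficient is the form in
`sparsePoint_quadratic_ne`. Six cubic monomials remain, three of each sign, hence the bound 3M³. -/
lemma sparsePoint_det_ne {a b c d p q : ℕ} (hab : a < b) (hcd : c < d) (hpq : p < q)
    (hac : a ≠ c) (had : a ≠ d) (hbc : b ≠ c) (hbd : b ≠ d)
    (hap : a ≠ p) (haq : a ≠ q) (hbp : b ≠ p) (hbq : b ≠ q)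
    (hcp : c ≠ p) (hcq : c ≠ q) (hdp : d ≠ p) (hdq : d ≠ q) :
    (sparsePoint a + sparsePoint b - (sparsePoint c + sparsePoint d)) *
        (sparsePoint a * sparsePoint b - sparsePoint p * sparsePoint q) -
      (sparsePoint a + sparsePoint b - (sparsePoint p + sparsePoint q)) *
        (sparsePoint a * sparsePoint b - sparsePoint c * sparsePoint d) ≠ 0 := by
  wlog h : d < b generalizing a b c d
  · intro h0
    exact this hcd hab hac.symm hbc.symm had.symm hbd.symm hcp hcq hdp hdq hap haq hbp hbq
      (by omega) (by linarith)
  wlog h' : q < b generalizing a b c d p q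
  · intro h0
    apply this (a := p) (b := q) (c := c) (d := d) (p := a) (q := b) <;> first | omega | linarith
  have hpos := one_le_sparsePoint
  obtain ⟨M, hM, hMb, hle⟩ := exists_sparsePoint_bound (Nat.zero_lt_of_lt h)
  have ha := hle a (by omega)
  have hc := hle c (by omega)
  have hd := hle d (by omega)
  have hp := hle p (by omega)
  have hq := hle q (by omega)
  have bd : ∀ x y z : ℕ, sparsePoint x ≤ M → sparsePoint y ≤ M → sparsePoint z ≤ M →
      0 < sparsePoint x * (sparsePoint y * sparsePoint z) ∧
      sparsePoint x * (sparsePoint y * sparsePoint z) ≤ M ^ 3 := by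
    intro x y z hx hy hz
    have h1 : 0 < sparsePoint y * sparsePoint z :=
      mul_pos (by linarith [hpos y]) (by linarith [hpos z])
    have h2 : sparsePoint y * sparsePoint z ≤ M * M :=
      mul_le_mul hy hz (by linarith [hpos z]) (by linarith)
    refine ⟨mul_pos (by linarith [hpos x]) h1, ?_⟩
    calc _ ≤ M * (M * M) := mul_le_mul hx h2 h1.le (by linarith)
      _ = M ^ 3 := by ring
  have h1 := mul_add_ne_zero_of_lt (z := sparsePoint b) (C := 3 * M ^ 3)
    (c := sparsePoint a * (sparsePoint c * sparsePoint d) -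
      sparsePoint a * (sparsePoint p * sparsePoint q) +
      sparsePoint c * (sparsePoint p * sparsePoint q) +
      sparsePoint d * (sparsePoint p * sparsePoint q) -
      sparsePoint p * (sparsePoint c * sparsePoint d) -
      sparsePoint q * (sparsePoint c * sparsePoint d))
    (sparsePoint_quadratic_ne hcd hpq hdq hac.symm had.symm hap.symm haq.symm) ?_ hMb
  · contrapose! h1
    linarith
  · have h2 := bd a c d ha hc hd
    have h3 := bd a p q ha hp hq
    have h4 := bd c p q hc hp hq
    have h5 := bd d p q hd hp hq
    have h6 := bd p c d hp hc hd
    have h7 := bd q c d hq hc hd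
    rw [abs_le]
    constructor <;> linarith [h2.1, h2.2, h3.1, h3.2, h4.1, h4.2, h5.1, h5.2, h6.1, h6.2, h7.1, h7.2]

/-! ### Two-page book drawings by parabolic arcs -/

namespace SimpleGraph

variable {V : Type*} {G : SimpleGraph V}

/-- The parabolic arc over the segment from `(p, 0)` to `(q, 0)`, on the side of the axis
given by the sign of `s`. -/
def parabolicArc (s p q : ℝ) : C(unitInterval, ℝ × ℝ) where
  toFun t := (p + (q - p) * t, s * ((q - p) ^ 2 * (t * (1 - t))))

lemma parabolicArc_injective (s : ℝ) {p q : ℝ} (h : p < q) :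
    Function.Injective (parabolicArc s p q) := by
  intro t u htu
  have h1 : p + (q - p) * (t : ℝ) = p + (q - p) * u := congrArg Prod.fst htu
  exact Subtype.ext (mul_left_cancel₀ (sub_pos.mpr h).ne' (add_left_cancel h1))

/-- The leading coefficient depends on `s` alone, so the heights of two arcs on one page differ by a
linear function of the abscissa. -/
lemma mem_parabolicArc {s p q : ℝ} (h : p < q) {z : ℝ × ℝ}
    (hz : z ∈ parabolicArc s p q '' Set.Ioo 0 1) :
    p < z.1 ∧ z.1 < q ∧ z.2 = s * ((z.1 - p) * (q - z.1)) := by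
  obtain ⟨t, ⟨h0, h1⟩, rfl⟩ := hz
  have h0 : (0 : ℝ) < t := h0
  have h1 : (t : ℝ) < 1 := h1
  have hqp := sub_pos.mpr h
  simp only [parabolicArc, ContinuousMap.coe_mk]
  refine ⟨by nlinarith, by nlinarith, by ring⟩

namespace BookDrawing

variable (pos : V → ℕ) (page : Sym2 V → Bool)

/-- The smaller of the positions of the two ends of an edge. -/
def lo (e : Sym2 V) : ℕ := (e.map pos).inf

/-- The larger of the positions of the two ends of an edge. -/
def hi (e : Sym2 V) : ℕ := (e.map pos).sup

/-- The side of the axis on which a page lies. -/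
def side (b : Bool) : ℝ := if b then 1 else -1

lemma side_eq_of_mul_pos {b c : Bool} {x y : ℝ} (hx : 0 < x) (hy : 0 < y)
    (h : side b * x = side c * y) : b = c ∧ x = y := by
  cases b <;> cases c <;> simp only [side] at h <;> norm_num at h ⊢ <;> linarith

lemma s_lo_hi (e : Sym2 V) : s(lo pos e, hi pos e) = e.map pos := by
  induction e with | _ a b => ?_
  simp only [lo, hi, Sym2.map_mk, Sym2.inf_mk, Sym2.sup_mk]
  rcases le_total (pos a) (pos b) with h | h
  · simp [h]
  · simp [h, Sym2.eq_swap]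

variable {pos page}

lemma lo_lt_hi (hpos : Function.Injective pos) {e : Sym2 V} (he : e ∈ G.edgeSet) :
    lo pos e < hi pos e := by
  induction e with | _ a b => ?_
  have : pos a ≠ pos b := hpos.ne (G.ne_of_adj he)
  simpa [lo, hi, eq_comm] using this

lemma ext_lo_hi (hpos : Function.Injective pos) {e f : Sym2 V} (hlo : lo pos e = lo pos f)
    (hhi : hi pos e = hi pos f) : e = f := by
  apply Sym2.map.injective hpos
  rw [← s_lo_hi, ← s_lo_hi, hlo, hhi]

/-- Edges with an end at a common position are adjacent. -/
lemma exists_common {e f : Sym2 V} (hpos : Function.Injective pos) {n : ℕ}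
    (he : n = lo pos e ∨ n = hi pos e) (hf : n = lo pos f ∨ n = hi pos f) :
    ∃ v, v ∈ e ∧ v ∈ f := by
  have key : ∀ e : Sym2 V, n = lo pos e ∨ n = hi pos e → ∃ v ∈ e, pos v = n := by
    intro e he
    have : n ∈ e.map pos := by rw [← s_lo_hi]; simpa using he
    simpa using this
  obtain ⟨v, hv, hvn⟩ := key e he
  obtain ⟨w, hw, hwn⟩ := key f hf
  exact ⟨v, hv, by rwa [hpos (hvn.trans hwn.symm)]⟩

lemma lo_or_hi_of_mem {e : Sym2 V} {v : V} (hv : v ∈ e) :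
    pos v = lo pos e ∨ pos v = hi pos e := by
  have : pos v ∈ e.map pos := Sym2.mem_map.mpr ⟨v, hv, rfl⟩
  rwa [← s_lo_hi, Sym2.mem_iff] at this

lemma cast_sparsePoint_strictMono : StrictMono fun n => (sparsePoint n : ℝ) :=
  Int.cast_strictMono.comp sparsePoint_strictMono

variable (G page) in
/-- The two-page book drawing: the vertices are placed on the axis at sparse points, in the
order given by `pos`, and the edges are parabolic arcs above or below the axis. -/
noncomputable def drawing (hpos : Function.Injective pos) : G.PlaneDrawing where
  point v := (sparsePoint (pos v), 0)
  point_injective v w h :=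
    hpos (cast_sparsePoint_strictMono.injective (congrArg Prod.fst h))
  curve e := parabolicArc (side (page e)) (sparsePoint (lo pos e)) (sparsePoint (hi pos e))
  curve_ends e := by
    have h := congrArg (Sym2.map fun n => (((sparsePoint n : ℝ), (0 : ℝ)) : ℝ × ℝ))
      (s_lo_hi pos (e : Sym2 V))
    rw [Sym2.map_map, Sym2.map_mk] at h
    simpa [parabolicArc, Function.comp_def] using h
  curve_avoids e v t h0 h1 h := by
    have hlt := cast_sparsePoint_strictMono (lo_lt_hi hpos e.2)
    obtain ⟨h2, h3, h4⟩ := mem_parabolicArc hlt (Set.mem_image_of_mem _ ⟨h0, h1⟩)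
    rw [h] at h2 h3 h4
    -- The height is nonzero strictly between the ends, whereas all vertices lie on the axis.
    have := mul_pos (sub_pos.mpr h2) (sub_pos.mpr h3)
    cases hb : page e <;> simp only [hb, side] at h4 <;> norm_num at h4 <;> 
      simp only [sub_eq_zero] at h4 <;> simp at * <;> grind

variable (pos page) in
/-- The edges `e` and `f` lie on the same page and their ends interleave, `e` starting first. -/
def Interleave (e f : Sym2 V) : Prop :=
  page e = page f ∧ lo pos e < lo pos f ∧ lo pos f < hi pos e ∧ hi pos e < hi pos f

/-- What a crossing of two distinct edges of a book drawing looks like. -/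
lemma of_mem_crossingsOf (hpos : Function.Injective pos) {e f : G.edgeSet} (hef : e ≠ f)
    {z : ℝ × ℝ} (hz : z ∈ (drawing G page hpos).crossingsOf e f) :
    (Interleave pos page e f ∨ Interleave pos page f e) ∧
    (sparsePoint (lo pos e) + sparsePoint (hi pos e) -
      (sparsePoint (lo pos f) + sparsePoint (hi pos f)) : ℝ) ≠ 0 ∧
    (sparsePoint (lo pos e) + sparsePoint (hi pos e) -
      (sparsePoint (lo pos f) + sparsePoint (hi pos f)) : ℝ) * z.1 =
    sparsePoint (lo pos e) * sparsePoint (hi pos e) -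
      sparsePoint (lo pos f) * sparsePoint (hi pos f) ∧
    z.2 = side (page e) *
      ((z.1 - sparsePoint (lo pos e)) * (sparsePoint (hi pos e) - z.1)) := by
  have hmono := cast_sparsePoint_strictMono
  have hlte := lo_lt_hi hpos e.2
  have hltf := lo_lt_hi hpos f.2
  obtain ⟨h1, h2, h3⟩ := mem_parabolicArc (hmono hlte) hz.1
  obtain ⟨k1, k2, k3⟩ := mem_parabolicArc (hmono hltf) hz.2
  have hext := fun h h' => hef (Subtype.ext (ext_lo_hi (e := (e : Sym2 V)) (f := f) hpos h h'))
  obtain ⟨hp, hy⟩ := side_eq_of_mul_pos (mul_pos (sub_pos.mpr h1) (sub_pos.mpr h2))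
    (mul_pos (sub_pos.mpr k1) (sub_pos.mpr k2)) (h3.symm.trans k3)
  have hlin : (sparsePoint (lo pos e) + sparsePoint (hi pos e) -
      (sparsePoint (lo pos f) + sparsePoint (hi pos f)) : ℝ) * z.1 =
      sparsePoint (lo pos e) * sparsePoint (hi pos e) -
        sparsePoint (lo pos f) * sparsePoint (hi pos f) := by linarith
  refine ⟨?_, ?_, hlin, h3⟩
  · rcases lt_trichotomy (lo pos (e : Sym2 V)) (lo pos f) with h | h | h
    · refine Or.inl ⟨hp, h, hmono.lt_iff_lt.mp (k1.trans h2), ?_⟩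
      -- Were the segment of `f` nested in that of `e`, the arc of `e` would be strictly farther
      -- from the axis.
      by_contra! hle
      have := hmono h
      have := hmono.monotone hle
      dsimp only at *
      nlinarith
    · rw [h] at hy
      have := mul_left_cancel₀ (sub_pos.mpr k1).ne' hy
      exact absurd (hmono.injective (by linarith)) (hext h)
    · refine Or.inr ⟨hp.symm, h, hmono.lt_iff_lt.mp (h1.trans k2), ?_⟩
      by_contra! hle
      have := hmono h
      have := hmono.monotone hle
      dsimp only at *
      nlinarith
  · intro h0
    rw [h0, zero_mul] at hlin
    -- With equal sums and equal products of the ends, the left end of `f` is a root of the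
    -- quadratic whose roots are the ends of `e`.
    have h5 : ((sparsePoint (lo pos (f : Sym2 V)) : ℝ) - sparsePoint (lo pos (e : Sym2 V))) *
        (sparsePoint (hi pos (e : Sym2 V)) - sparsePoint (lo pos (f : Sym2 V))) = 0 := by
      linear_combination (sparsePoint (lo pos (f : Sym2 V)) : ℝ) * h0 + hlin
    rcases mul_eq_zero.mp h5 with h6 | h6
    · have h7 : lo pos (e : Sym2 V) = lo pos f := hmono.injective (by linarith)
      exact hext h7 (hmono.injective (by rw [h7] at h0; linarith))
    · linarith

lemma Interleave.not_adjacent {e f : Sym2 V}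
    (h : Interleave pos page e f) : ¬ ∃ v, v ∈ e ∧ v ∈ f := by
  rintro ⟨v, he, hf⟩
  obtain ⟨-, h1, h2, h3⟩ := h
  have := lo_or_hi_of_mem (pos := pos) he
  have := lo_or_hi_of_mem (pos := pos) hf
  omega

lemma not_adjacent_of_mem_crossingsOf (hpos : Function.Injective pos) {e f : G.edgeSet}
    (hef : e ≠ f) {z : ℝ × ℝ} (hz : z ∈ (drawing G page hpos).crossingsOf e f) :
    ¬ ∃ v, v ∈ (e : Sym2 V) ∧ v ∈ (f : Sym2 V) := by
  rcases (of_mem_crossingsOf hpos hef hz).1 with h | h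
  · exact h.not_adjacent
  · simpa only [and_comm] using h.not_adjacent

lemma drawing_isGood (hpos : Function.Injective pos) : (drawing G page hpos).IsGood where
  not_self_crossing e :=
    parabolicArc_injective _ (cast_sparsePoint_strictMono (lo_lt_hi hpos e.2))
  adjacent_not_crossing e f hef hv := Set.eq_empty_of_forall_notMem fun z hz =>
    not_adjacent_of_mem_crossingsOf hpos hef hz hv
  crossing_once e f hef z hz w hw := by
    obtain ⟨-, h1, h2, h3⟩ := of_mem_crossingsOf hpos hef hz
    obtain ⟨-, -, k2, k3⟩ := of_mem_crossingsOf hpos hef hw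
    have h4 := mul_left_cancel₀ h1 (h2.trans k2.symm)
    exact Prod.ext h4 (by rw [h3, k3, h4])
  no_triple_crossing e f g hef hfg heg := by
    refine Set.eq_empty_of_forall_notMem fun z hz => ?_
    obtain ⟨hz1, hz2⟩ := hz
    have hz3 : z ∈ (drawing G page hpos).crossingsOf f g := ⟨hz1.2, hz2.2⟩
    have n1 := not_adjacent_of_mem_crossingsOf hpos hef hz1
    have n2 := not_adjacent_of_mem_crossingsOf hpos heg hz2
    have n3 := not_adjacent_of_mem_crossingsOf hpos hfg hz3
    have h1 := (of_mem_crossingsOf hpos hef hz1).2.2.1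
    have h2 := (of_mem_crossingsOf hpos heg hz2).2.2.1
    have le := lo_lt_hi hpos e.2
    have lf := lo_lt_hi hpos f.2
    have lg := lo_lt_hi hpos g.2
    have key := sparsePoint_det_ne le lf lg
      (fun h => n1 (exists_common hpos (.inl rfl) (.inl h)))
      (fun h => n1 (exists_common hpos (.inl rfl) (.inr h)))
      (fun h => n1 (exists_common hpos (.inr rfl) (.inl h)))
      (fun h => n1 (exists_common hpos (.inr rfl) (.inr h)))
      (fun h => n2 (exists_common hpos (.inl rfl) (.inl h)))
      (fun h => n2 (exists_common hpos (.inl rfl) (.inr h)))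
      (fun h => n2 (exists_common hpos (.inr rfl) (.inl h)))
      (fun h => n2 (exists_common hpos (.inr rfl) (.inr h)))
      (fun h => n3 (exists_common hpos (.inl rfl) (.inl h)))
      (fun h => n3 (exists_common hpos (.inl rfl) (.inr h)))
      (fun h => n3 (exists_common hpos (.inr rfl) (.inl h)))
      (fun h => n3 (exists_common hpos (.inr rfl) (.inr h)))
    -- The abscissa of a triple point satisfies two linear equations; eliminating it makes the
    -- determinant vanish.
    apply key
    rify
    rw [← h1, ← h2]
    ring

/-- The crossing number is at most the number of interleaving pairs of a book drawing. -/
theorem crossingNumber_le (hpos : Function.Injective pos) (page : Sym2 V → Bool) :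
    G.crossingNumber ≤ {x : G.edgeSet × G.edgeSet | Interleave pos page x.1 x.2}.encard := by
  classical
  -- Sends a pair of edges to its crossing point. The value 0 for pairs that do not cross is
  -- harmless, since only coverage of the crossings matters.
  let z : G.edgeSet × G.edgeSet → ℝ × ℝ := fun x =>
    if h : ((drawing G page hpos).crossingsOf x.1 x.2).Nonempty then h.some else 0
  have hgood := drawing_isGood (G := G) (page := page) hpos
  refine (iInf₂_le (drawing G page hpos) hgood).trans ?_
  refine (Set.encard_le_encard ?_).trans (Set.encard_image_le z _)
  rintro w ⟨e, f, hef, hw⟩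
  have hz : ∀ e f : G.edgeSet, e ≠ f → w ∈ (drawing G page hpos).crossingsOf e f →
      z (e, f) = w := fun e f hef hw => by
    have h : ((drawing G page hpos).crossingsOf e f).Nonempty := ⟨w, hw⟩
    simp only [z, dif_pos h]
    exact hgood.crossing_once e f hef h.some_mem hw
  rcases (of_mem_crossingsOf hpos hef hw).1 with h | h
  · exact ⟨(e, f), h, hz e f hef hw⟩
  · exact ⟨(f, e), h, hz f e hef.symm hw.symm⟩

end BookDrawing
end SimpleGraph

/-! ### Counting crossing and touching pairs under doubling -/

/-- An arc of a two-page book drawing: its page and the positions of its two ends. -/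
structure Arc where
  /-- the page of the arc -/
  page : Bool
  /-- the position of the left end -/
  lo : ℕ
  /-- the position of the right end -/
  hi : ℕ

namespace Arc

/-- The arcs lie on the same page and interleave, `a` starting first. -/
def Crosses (a b : Arc) : Prop :=
  a.page = b.page ∧ a.lo < b.lo ∧ b.lo < a.hi ∧ a.hi < b.hi

/-- The arcs lie on the same page and share exactly one end; the order of `a` and `b` is the one
in which they cross after a small displacement of the common end. -/
def Touches (a b : Arc) : Prop :=
  a.page = b.page ∧
    (a.lo = b.lo ∧ a.hi < b.hi ∨ a.lo < b.lo ∧ a.hi = b.hi ∨ a.hi = b.lo)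

instance : DecidableRel Crosses := fun _ _ => inferInstanceAs (Decidable (_ ∧ _))

instance : DecidableRel Touches := fun _ _ => inferInstanceAs (Decidable (_ ∧ _))

lemma Crosses.asymm {a b : Arc} (h : a.Crosses b) : ¬ b.Crosses a := by
  rintro ⟨-, h', -⟩
  exact h'.not_gt h.2.1

lemma Touches.asymm {a b : Arc} (ha : a.lo < a.hi) (hb : b.lo < b.hi) (h : a.Touches b) :
    ¬ b.Touches a := by
  rintro ⟨-, h'⟩
  have := h.2
  omega

end Arc

open Finset

section Pairs

variable {α β : Type*}

/-- The pairs of members of `s` whose arcs are related by `R`. -/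
def relPairs (R : Arc → Arc → Prop) [DecidableRel R] (A : α → Arc) (s t : Finset α) :
    Finset (α × α) :=
  (s ×ˢ t).filter fun x => R (A x.1) (A x.2)

lemma mem_relPairs {R : Arc → Arc → Prop} [DecidableRel R] {A : α → Arc} {s t : Finset α}
    {x : α × α} : x ∈ relPairs R A s t ↔ (x.1 ∈ s ∧ x.2 ∈ t) ∧ R (A x.1) (A x.2) := by
  simp [relPairs]

/-- The related pairs of a union of two sets of arcs. -/
lemma card_relPairs_union_le [DecidableEq α] (R : Arc → Arc → Prop) [DecidableRel R] (A : α → Arc)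
    (s t : Finset α)
    (hR : ∀ e ∈ s, ∀ f ∈ t, R (A e) (A f) → ¬ R (A f) (A e)) :
    (relPairs R A (s ∪ t) (s ∪ t)).card ≤ (relPairs R A s s).card + (relPairs R A t t).card +
      (relPairs (fun a b => R a b ∨ R b a) A t s).card := by
  have h1 : relPairs R A (s ∪ t) (s ∪ t) ⊆ (relPairs R A s s ∪ relPairs R A t t) ∪
      (relPairs R A t s ∪ relPairs R A s t) := by
    intro x
    simp only [mem_union, mem_relPairs]
    tauto
  have h2 : (relPairs R A s t).card = ((relPairs R A s t).image Prod.swap).card :=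
    (card_image_of_injective _ Prod.swap_injective).symm
  have h3 : (relPairs R A t s).card + (relPairs R A s t).card ≤
      (relPairs (fun a b => R a b ∨ R b a) A t s).card := by
    rw [h2, ← card_union_of_disjoint]
    · apply card_le_card
      rintro ⟨e, f⟩
      simp only [mem_union, mem_relPairs, mem_image, Prod.exists, Prod.swap_prod_mk,
        Prod.mk.injEq]
      rintro (h | ⟨a, b, h, rfl, rfl⟩) <;> tauto
    · rw [Finset.disjoint_left]
      rintro ⟨e, f⟩ he hf
      simp only [mem_relPairs, mem_image, Prod.exists, Prod.swap_prod_mk, Prod.mk.injEq] at he hf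
      obtain ⟨a, b, h, rfl, rfl⟩ := hf
      exact hR _ h.1.1 _ h.1.2 h.2 he.2
  have := (card_le_card h1).trans (card_union_le _ _)
  have := card_union_le (relPairs R A s s) (relPairs R A t t)
  have := card_union_le (relPairs R A t s) (relPairs R A s t)
  omega

/-- `IsDoubling π bit A' A s' s` says that the arcs `A'` of `s'` arise from the arcs `A` of `s` by
replacing every position by four consecutive ones and every arc by two antiparallel ones, which
are distinguished by `bit`, in such a way that the copies of one end agree on each page. -/
structure IsDoubling (π : β → α) (bit : β → Bool) (A' : β → Arc) (A : α → Arc)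
    (s' : Finset β) (s : Finset α) : Prop where
  mapsTo : ∀ e ∈ s', π e ∈ s
  inj : ∀ e ∈ s', ∀ f ∈ s', π e = π f → bit e = bit f → e = f
  page_eq : ∀ e ∈ s', (A' e).page = (A (π e)).page
  lo_div : ∀ e ∈ s', (A' e).lo / 4 = (A (π e)).lo
  hi_div : ∀ e ∈ s', (A' e).hi / 4 = (A (π e)).hi
  lo_lo : ∀ e ∈ s', ∀ f ∈ s', (A' e).page = (A' f).page → (A' e).lo / 4 = (A' f).lo / 4 →
    (bit e = bit f ↔ (A' e).lo = (A' f).lo)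
  hi_hi : ∀ e ∈ s', ∀ f ∈ s', (A' e).page = (A' f).page → (A' e).hi / 4 = (A' f).hi / 4 →
    (bit e = bit f ↔ (A' e).hi = (A' f).hi)
  hi_lo : ∀ e ∈ s', ∀ f ∈ s', (A' e).page = (A' f).page → (A' e).hi / 4 = (A' f).lo / 4 →
    (bit e = bit f ↔ (A' e).hi = (A' f).lo)
  anti : ∀ e ∈ s', ∀ f ∈ s', π e = π f → (A' e).lo < (A' f).lo → (A' f).hi < (A' e).hi
  simple : ∀ e ∈ s, ∀ f ∈ s, (A e).lo = (A f).lo → (A e).hi = (A f).hi → e = f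
  lo_lt_hi : ∀ e ∈ s, (A e).lo < (A e).hi

variable {π : β → α} {bit : β → Bool} {A' : β → Arc} {A : α → Arc}
  {s' : Finset β} {s : Finset α}

/-- Division by 4 turns the strict inequalities of an interleaving into weak ones. If all stay
strict the originals cross; an equality is a common end. Two copies of one arc are nested, so they
do not cross. -/
lemma IsDoubling.crosses_or_touches (h : IsDoubling π bit A' A s' s) {e f : β} (he : e ∈ s')
    (hf : f ∈ s') (hR : (A' e).Crosses (A' f)) :
    (A (π e)).Crosses (A (π f)) ∨ (A (π e)).Touches (A (π f)) := by
  obtain ⟨h0, h1, h2, h3⟩ := hR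
  simp only [Arc.Crosses, Arc.Touches, ← h.page_eq e he, ← h.page_eq f hf, h0, true_and]
  by_cases hef : π e = π f
  · have := h.anti e he f hf hef h1
    omega
  · have := fun k => mt (h.simple _ (h.mapsTo e he) _ (h.mapsTo f hf) k) hef
    have := h.lo_div e he
    have := h.lo_div f hf
    have := h.hi_div e he
    have := h.hi_div f hf
    omega

/-- At a common end the bit determines one of two positions, so the order in which two copies arrive
there determines both bits. -/
lemma bool_eq_of_lt {x y x₂ y₂ : Bool} {p q p₂ q₂ : ℕ} (h₁ : x = y ↔ p = q)
    (h₂ : x₂ = y₂ ↔ p₂ = q₂) (h₃ : x = y₂ ↔ p = q₂) (h₄ : x₂ = y ↔ p₂ = q)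
    (h₅ : x = x₂ ↔ p = p₂) (hpq : p < q ∧ p₂ < q₂ ∨ q < p ∧ q₂ < p₂) : x = x₂ ∧ y = y₂ := by
  cases x <;> cases y <;> cases x₂ <;> cases y₂ <;> simp at * <;> omega

/-- Each touching pair gives rise to at most one crossing. -/
lemma IsDoubling.bit_eq_of_touches (h : IsDoubling π bit A' A s' s) {e f e₂ f₂ : β}
    (he : e ∈ s') (hf : f ∈ s') (he₂ : e₂ ∈ s') (hf₂ : f₂ ∈ s') (hee : π e = π e₂)
    (hff : π f = π f₂) (hR : (A' e).Crosses (A' f)) (hR₂ : (A' e₂).Crosses (A' f₂))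
    (hT : (A (π e)).Touches (A (π f))) : bit e = bit e₂ ∧ bit f = bit f₂ := by
  obtain ⟨h0, h1, h2, h3⟩ := hR
  obtain ⟨k0, k1, k2, k3⟩ := hR₂
  obtain ⟨-, hT⟩ := hT
  have pe : (A' e).page = (A' e₂).page := by rw [h.page_eq e he, h.page_eq e₂ he₂, hee]
  have a1 := h.lo_div e he
  have a2 := h.lo_div f hf
  have a3 := h.hi_div e he
  have a4 := h.hi_div f hf
  have b1 := h.lo_div e₂ he₂
  have b2 := h.lo_div f₂ hf₂
  have b3 := h.hi_div e₂ he₂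
  have b4 := h.hi_div f₂ hf₂
  rw [← hee] at b1 b3
  rw [← hff] at b2 b4
  rcases hT with ⟨t, -⟩ | ⟨-, t⟩ | t
  · have c1 := h.lo_lo e he f hf h0 (by omega)
    have c2 := h.lo_lo e₂ he₂ f₂ hf₂ k0 (by omega)
    have c3 := h.lo_lo e he f₂ hf₂ (pe.trans k0) (by omega)
    have c4 := h.lo_lo e₂ he₂ f hf (pe.symm.trans h0) (by omega)
    have c5 := h.lo_lo e he e₂ he₂ pe (by omega)
    exact bool_eq_of_lt c1 c2 c3 c4 c5 (by omega)
  · have c1 := h.hi_hi e he f hf h0 (by omega)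
    have c2 := h.hi_hi e₂ he₂ f₂ hf₂ k0 (by omega)
    have c3 := h.hi_hi e he f₂ hf₂ (pe.trans k0) (by omega)
    have c4 := h.hi_hi e₂ he₂ f hf (pe.symm.trans h0) (by omega)
    have c5 := h.hi_hi e he e₂ he₂ pe (by omega)
    exact bool_eq_of_lt c1 c2 c3 c4 c5 (by omega)
  · have c1 := h.hi_lo e he f hf h0 (by omega)
    have c2 := h.hi_lo e₂ he₂ f₂ hf₂ k0 (by omega)
    have c3 := h.hi_lo e he f₂ hf₂ (pe.trans k0) (by omega)
    have c4 := h.hi_lo e₂ he₂ f hf (pe.symm.trans h0) (by omega)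
    have c5 := h.hi_hi e he e₂ he₂ pe (by omega)
    exact bool_eq_of_lt c1 c2 c3 c4 c5 (by omega)

/-- A crossing pair of originals has 2·2 pairs of copies, recorded by their bits. Over a touching
pair no bits need recording, by `bit_eq_of_touches`. -/
lemma IsDoubling.card_crosses_le (h : IsDoubling π bit A' A s' s) :
    (relPairs Arc.Crosses A' s' s').card ≤
      4 * (relPairs Arc.Crosses A s s).card + (relPairs Arc.Touches A s s).card := by
  classical
  set X := relPairs Arc.Crosses A' s' s'
  set X₁ := X.filter fun x => (A (π x.1)).Crosses (A (π x.2))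
  set X₂ := X.filter fun x => (A (π x.1)).Touches (A (π x.2))
  have hX : X ⊆ X₁ ∪ X₂ := by
    intro x hx
    have hx' := mem_relPairs.mp hx
    rcases h.crosses_or_touches hx'.1.1 hx'.1.2 hx'.2 with hc | hc
    · exact mem_union_left _ (mem_filter.mpr ⟨hx, hc⟩)
    · exact mem_union_right _ (mem_filter.mpr ⟨hx, hc⟩)
  have h1 : X₁.card ≤ (relPairs Arc.Crosses A s s ×ˢ (univ : Finset (Bool × Bool))).card := by
    refine card_le_card_of_injOn (fun x => ((π x.1, π x.2), (bit x.1, bit x.2))) ?_ ?_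
    · intro x hx
      obtain ⟨hx, hc⟩ := mem_filter.mp hx
      have hx := mem_relPairs.mp hx
      simpa using mem_relPairs.mpr ⟨⟨h.mapsTo _ hx.1.1, h.mapsTo _ hx.1.2⟩, hc⟩
    · intro x hx y hy hxy
      have hx := (mem_relPairs.mp (mem_filter.mp hx).1).1
      have hy := (mem_relPairs.mp (mem_filter.mp hy).1).1
      simp only [Prod.mk.injEq] at hxy
      exact Prod.ext (h.inj _ hx.1 _ hy.1 hxy.1.1 hxy.2.1) (h.inj _ hx.2 _ hy.2 hxy.1.2 hxy.2.2)
  have h2 : X₂.card ≤ (relPairs Arc.Touches A s s).card := by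
    refine card_le_card_of_injOn (fun x => (π x.1, π x.2)) ?_ ?_
    · intro x hx
      obtain ⟨hx, hc⟩ := mem_filter.mp hx
      have hx := mem_relPairs.mp hx
      exact mem_relPairs.mpr ⟨⟨h.mapsTo _ hx.1.1, h.mapsTo _ hx.1.2⟩, hc⟩
    · intro x hx y hy hxy
      obtain ⟨hx, ht⟩ := mem_filter.mp hx
      have hx := mem_relPairs.mp hx
      have hy := mem_relPairs.mp (mem_filter.mp hy).1
      simp only [Prod.mk.injEq] at hxy
      obtain ⟨b1, b2⟩ := h.bit_eq_of_touches hx.1.1 hx.1.2 hy.1.1 hy.1.2 hxy.1 hxy.2 hx.2 hy.2 ht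
      exact Prod.ext (h.inj _ hx.1.1 _ hy.1.1 hxy.1 b1) (h.inj _ hx.1.2 _ hy.1.2 hxy.2 b2)
  have h3 := (card_le_card hX).trans (card_union_le _ _)
  have h4 : (univ : Finset (Bool × Bool)).card = 4 := rfl
  rw [card_product, h4] at h1
  omega

/-- On one page, copies of a common end coincide only for equal bits. Hence a touching pair of
originals has at most two touching pairs of copies. -/
lemma IsDoubling.touches (h : IsDoubling π bit A' A s' s) {e f : β} (he : e ∈ s')
    (hf : f ∈ s') (hR : (A' e).Touches (A' f)) :
    bit e = bit f ∧ (A (π e)).Touches (A (π f)) := by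
  obtain ⟨h0, hR⟩ := hR
  have a1 := h.lo_div e he
  have a2 := h.lo_div f hf
  have a3 := h.hi_div e he
  have a4 := h.hi_div f hf
  have hb : bit e = bit f := by
    rcases hR with ⟨t, -⟩ | ⟨-, t⟩ | t
    · exact (h.lo_lo e he f hf h0 (by omega)).mpr t
    · exact (h.hi_hi e he f hf h0 (by omega)).mpr t
    · exact (h.hi_lo e he f hf h0 (by omega)).mpr t
  refine ⟨hb, ?_⟩
  simp only [Arc.Touches, ← h.page_eq e he, ← h.page_eq f hf, h0, true_and]
  by_cases hef : π e = π f
  · have hle := h.lo_lt_hi _ (h.mapsTo e he)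
    obtain rfl := h.inj e he f hf hef hb
    omega
  · have := fun k => mt (h.simple _ (h.mapsTo e he) _ (h.mapsTo f hf) k) hef
    omega

lemma IsDoubling.card_touches_le (h : IsDoubling π bit A' A s' s) :
    (relPairs Arc.Touches A' s' s').card ≤ 2 * (relPairs Arc.Touches A s s).card := by
  have h1 : (relPairs Arc.Touches A' s' s').card ≤
      (relPairs Arc.Touches A s s ×ˢ (univ : Finset Bool)).card := by
    refine card_le_card_of_injOn (fun x => ((π x.1, π x.2), bit x.1)) ?_ ?_
    · intro x hx
      have hx := mem_relPairs.mp hx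
      simpa using mem_relPairs.mpr
        ⟨⟨h.mapsTo _ hx.1.1, h.mapsTo _ hx.1.2⟩, (h.touches hx.1.1 hx.1.2 hx.2).2⟩
    · intro x hx y hy hxy
      have hx := mem_relPairs.mp hx
      have hy := mem_relPairs.mp hy
      have b1 := (h.touches hx.1.1 hx.1.2 hx.2).1
      have b2 := (h.touches hy.1.1 hy.1.2 hy.2).1
      simp only [Prod.mk.injEq] at hxy
      exact Prod.ext (h.inj _ hx.1.1 _ hy.1.1 hxy.1.1 hxy.2)
        (h.inj _ hx.1.2 _ hy.1.2 hxy.1.2 (by rw [← b1, ← b2, hxy.2]))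
  rw [card_product, card_univ, Fintype.card_bool] at h1
  omega

end Pairs

/-! ### Coded edges, layouts and the doubling construction -/

namespace WrappedButterfly

/-- Flip the bit with index `i` of the `r`-bit row `w` if `c` holds.  Rows are encoded as numbers,
the bit with index `0` being the most significant one. -/
def flip (r i w : ℕ) (c : Bool) : ℕ := if c then w ^^^ 2 ^ (r - 1 - i) else w

lemma flip_lt {r i w : ℕ} (hi : i < r) (hw : w < 2 ^ r) (c : Bool) : flip r i w c < 2 ^ r := by
  cases c
  · exact hw
  · exact Nat.xor_lt_two_pow hw (Nat.pow_lt_pow_right (by norm_num) (by omega))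

lemma flip_flip (r i w : ℕ) (c : Bool) : flip r i (flip r i w c) c = w := by
  cases c <;> simp [flip]

lemma flip_injective {r i w : ℕ} {c d : Bool} (h : flip r i w c = flip r i w d) : c = d := by
  have key : w ^^^ 2 ^ (r - 1 - i) ≠ w := by
    intro h
    have h' := congrArg (w ^^^ ·) h
    simp only [← Nat.xor_assoc, Nat.xor_self, Nat.zero_xor] at h'
    exact (Nat.two_pow_pos _).ne' h'
  cases c <;> cases d <;> simp_all [flip, eq_comm]

/-- Bit `0` is the most significant, so raising the dimension appends the new bit at the low end:
halving a row forgets it, and its parity is the new bit. -/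
lemma flip_succ_div {r i : ℕ} (hi : i < r) (w : ℕ) (c : Bool) :
    flip (r + 1) i w c / 2 = flip r i (w / 2) c := by
  cases c
  · rfl
  · obtain ⟨k, rfl⟩ := Nat.exists_eq_add_of_lt hi
    simp only [flip, if_true]
    rw [show i + k + 1 + 1 - 1 - i = k + 1 by omega, show i + k + 1 - 1 - i = k by omega,
      Nat.xor_div_two, pow_succ, Nat.mul_div_cancel _ (by norm_num)]

lemma flip_succ_mod {r i : ℕ} (hi : i < r) (w : ℕ) (c : Bool) :
    flip (r + 1) i w c % 2 = w % 2 := by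
  cases c
  · rfl
  · obtain ⟨k, rfl⟩ := Nat.exists_eq_add_of_lt hi
    simp only [flip, if_true]
    rw [show i + k + 1 + 1 - 1 - i = k + 1 by omega, Nat.xor_mod_two_eq, pow_succ]
    omega

lemma flip_last_div (r w : ℕ) (c : Bool) : flip (r + 1) r w c / 2 = w / 2 := by
  cases c <;> simp [flip, Nat.xor_div_two]

lemma flip_last_mod (r w : ℕ) (c : Bool) :
    flip (r + 1) r w c % 2 = if c then 1 - w % 2 else w % 2 := by
  cases c
  · rfl
  · simp only [flip, if_true]
    rw [show r + 1 - 1 - r = 0 by omega, Nat.xor_mod_two_eq]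
    omega

/-- The edges of the wrapped butterfly: `(i, w, c)` joins row `w` at level `i` to the next level,
and the bit with index `i` is flipped if `c` holds. -/
def edges (r : ℕ) : Finset (ℕ × ℕ × Bool) := range r ×ˢ range (2 ^ r) ×ˢ univ

lemma mem_edges {r : ℕ} {e : ℕ × ℕ × Bool} : e ∈ edges r ↔ e.1 < r ∧ e.2.1 < 2 ^ r := by
  simp [edges]

/-- A two-page layout of the wrapped butterfly: the position of each vertex on the axis and the
page of each edge. -/
structure Layout where
  /-- the position of a row at a level -/
  pos : ℕ → ℕ → ℕ
  /-- the page of an edge -/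
  page : ℕ → ℕ → Bool → Bool

namespace Layout

/-- The position of the tail of an edge. -/
def tail (L : Layout) (e : ℕ × ℕ × Bool) : ℕ := L.pos e.1 e.2.1

/-- The position of the head of an edge. -/
def head (L : Layout) (r : ℕ) (e : ℕ × ℕ × Bool) : ℕ :=
  L.pos ((e.1 + 1) % r) (flip r e.1 e.2.1 e.2.2)

/-- The arc that represents an edge. -/
def arc (L : Layout) (r : ℕ) (e : ℕ × ℕ × Bool) : Arc where
  page := L.page e.1 e.2.1 e.2.2
  lo := min (L.tail e) (L.head r e)
  hi := max (L.tail e) (L.head r e)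

/-- The positions of the vertices are different, and the edges out of level `0` and those into it
lie on different pages. -/
structure IsValid (L : Layout) (r : ℕ) : Prop where
  inj : ∀ i < r, ∀ j < r, ∀ w < 2 ^ r, ∀ v < 2 ^ r, L.pos i w = L.pos j v → i = j ∧ w = v
  page_first : ∀ w < 2 ^ r, ∀ c, L.page 0 w c = true
  page_last : ∀ w < 2 ^ r, ∀ c, L.page (r - 1) w c = false

/-- The layout of dimension `r + 1` in which every vertex of a layout of dimension `r` is doubled,
and the vertices at the new level `r` are interleaved with those at level `0`. -/
def double (L : Layout) (r : ℕ) : Layout where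
  -- Offsets in a block are 1 and 3 at level `0`, 0 and 2 at level `r`, and 0 and 1 elsewhere. The
  -- summand `i` in the parity reverses the order of the two copies from each level to the next, up
  -- to level `r`.
  pos i w := 4 * L.pos (i % r) (w / 2) +
    if i = 0 then 1 + 2 * ((w + i) % 2) else if i = r then 2 * ((w + i) % 2) else (w + i) % 2
  page i w c := if i < r then L.page i (w / 2) c else false

variable {L : Layout} {r : ℕ}

lemma add_one_mod {i : ℕ} (hi : i < r) : (i + 1) % r = if i + 1 = r then 0 else i + 1 := by
  split_ifs with h
  · rw [h, Nat.mod_self]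
  · exact Nat.mod_eq_of_lt (by omega)

lemma mod_of_le {i : ℕ} (hi : i ≤ r) : i % r = if i = r then 0 else i := by
  split_ifs with h
  · rw [h, Nat.mod_self]
  · exact Nat.mod_eq_of_lt (by omega)

namespace IsValid

variable (h : L.IsValid r) (hr : 3 ≤ r)
include h hr

lemma tail_ne_head {e : ℕ × ℕ × Bool} (he : e ∈ edges r) : L.tail e ≠ L.head r e := by
  rw [mem_edges] at he
  intro heq
  have := (h.inj _ he.1 _ (Nat.mod_lt _ (by omega)) _ he.2 _ (flip_lt he.1 he.2 _) heq).1
  rw [add_one_mod he.1] at this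
  split_ifs at this <;> omega

lemma lo_lt_hi {e : ℕ × ℕ × Bool} (he : e ∈ edges r) : (L.arc r e).lo < (L.arc r e).hi := by
  have := h.tail_ne_head hr he
  simpa [arc, eq_comm] using this

lemma arc_simple {e f : ℕ × ℕ × Bool} (he : e ∈ edges r) (hf : f ∈ edges r)
    (hlo : (L.arc r e).lo = (L.arc r f).lo) (hhi : (L.arc r e).hi = (L.arc r f).hi) : e = f := by
  have hlt := h.lo_lt_hi hr he
  rw [mem_edges] at he hf
  have h1 := h.inj _ he.1 _ hf.1 _ he.2 _ hf.2
  have h2 := h.inj _ (Nat.mod_lt (e.1 + 1) (by omega)) _ (Nat.mod_lt (f.1 + 1) (by omega)) _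
    (flip_lt he.1 he.2 e.2.2) _ (flip_lt hf.1 hf.2 f.2.2)
  have h3 := h.inj _ he.1 _ (Nat.mod_lt (f.1 + 1) (by omega)) _ he.2 _ (flip_lt hf.1 hf.2 f.2.2)
  have h4 := h.inj _ hf.1 _ (Nat.mod_lt (e.1 + 1) (by omega)) _ hf.2 _ (flip_lt he.1 he.2 e.2.2)
  change L.tail e = L.tail f → _ at h1
  change L.head r e = L.head r f → _ at h2
  change L.tail e = L.head r f → _ at h3
  change L.tail f = L.head r e → _ at h4
  simp only [arc] at hlo hhi hlt
  rcases (by omega : (L.tail e = L.tail f ∧ L.head r e = L.head r f) ∨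
      (L.tail e = L.head r f ∧ L.tail f = L.head r e)) with ⟨k1, k2⟩ | ⟨k1, k2⟩
  · have a := h1 k1
    have b := (h2 k2).2
    rw [← a.1, ← a.2] at b
    exact Prod.ext a.1 (Prod.ext a.2 (flip_injective b))
  · have a := (h3 k1).1
    have b := (h4 k2).1
    -- Reversed ends would make each level the cyclic successor of the other, which is impossible on
    -- a cycle of length at least 3.
    rw [add_one_mod hf.1] at a
    rw [add_one_mod he.1] at b
    split_ifs at a b <;> omega

end IsValid

end Layout
end WrappedButterfly

/-! ### The edges inherited from dimension `r` -/

namespace WrappedButterfly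

namespace Layout

variable {L : Layout} {r : ℕ}

lemma double_pos_div (ℓ u : ℕ) : (L.double r).pos ℓ u / 4 = L.pos (ℓ % r) (u / 2) := by
  simp only [double]
  split_ifs <;> omega

lemma double_pos_eq_iff {ℓ u v : ℕ} (huv : L.pos (ℓ % r) (u / 2) = L.pos (ℓ % r) (v / 2)) :
    (L.double r).pos ℓ u = (L.double r).pos ℓ v ↔ u % 2 = v % 2 := by
  simp only [double, huv]
  split_ifs <;> omega

lemma double_head_of_lt {e : ℕ × ℕ × Bool} (he : e.1 < r) :
    (L.double r).head (r + 1) e = (L.double r).pos (e.1 + 1) (flip (r + 1) e.1 e.2.1 e.2.2) := by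
  rw [head, Nat.mod_eq_of_lt (by omega)]

/-- The edges of the wrapped butterfly of dimension `r + 1` that come from dimension `r`. -/
def oldEdges (r : ℕ) : Finset (ℕ × ℕ × Bool) := (edges (r + 1)).filter (·.1 < r)

/-- The edges of the wrapped butterfly of dimension `r + 1` out of level `r`. -/
def newEdges (r : ℕ) : Finset (ℕ × ℕ × Bool) := (edges (r + 1)).filter (·.1 = r)

lemma mem_oldEdges {e : ℕ × ℕ × Bool} : e ∈ oldEdges r ↔ e.1 < r ∧ e.2.1 < 2 * 2 ^ r := by
  simp only [oldEdges, mem_filter, mem_edges, pow_succ]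
  omega

lemma mem_newEdges {e : ℕ × ℕ × Bool} : e ∈ newEdges r ↔ e.1 = r ∧ e.2.1 < 2 * 2 ^ r := by
  simp only [newEdges, mem_filter, mem_edges, pow_succ]
  omega

lemma oldEdges_union_newEdges (r : ℕ) : oldEdges r ∪ newEdges r = edges (r + 1) := by
  ext e
  simp only [mem_union, mem_oldEdges, mem_newEdges, mem_edges, pow_succ]
  omega

/-- The edge of dimension `r` from which an edge of dimension `r + 1` comes. -/
def project (e : ℕ × ℕ × Bool) : ℕ × ℕ × Bool := (e.1, e.2.1 / 2, e.2.2)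

/-- The copy of an edge of dimension `r` that an edge of dimension `r + 1` is. -/
def bit (e : ℕ × ℕ × Bool) : Bool := decide (e.2.1 % 2 = 1)

lemma bit_eq_iff {e f : ℕ × ℕ × Bool} : bit e = bit f ↔ e.2.1 % 2 = f.2.1 % 2 := by
  simp only [bit, decide_eq_decide]
  omega

/-- `IsEnd r e ℓ u` says that row `u` at level `ℓ` is an end of the edge `e` out of a level below
`r` in dimension `r + 1`. -/
def IsEnd (r : ℕ) (e : ℕ × ℕ × Bool) (ℓ u : ℕ) : Prop :=
  ℓ = e.1 ∧ u = e.2.1 ∨ ℓ = e.1 + 1 ∧ u = flip (r + 1) e.1 e.2.1 e.2.2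

lemma exists_isEnd_lo {e : ℕ × ℕ × Bool} (he : e ∈ oldEdges r) :
    ∃ ℓ u, IsEnd r e ℓ u ∧ ((L.double r).arc (r + 1) e).lo = (L.double r).pos ℓ u := by
  simp only [arc, tail, double_head_of_lt (mem_oldEdges.mp he).1]
  rcases min_choice ((L.double r).pos e.1 e.2.1)
    ((L.double r).pos (e.1 + 1) (flip (r + 1) e.1 e.2.1 e.2.2)) with h | h
  · exact ⟨_, _, .inl ⟨rfl, rfl⟩, h⟩
  · exact ⟨_, _, .inr ⟨rfl, rfl⟩, h⟩

lemma exists_isEnd_hi {e : ℕ × ℕ × Bool} (he : e ∈ oldEdges r) :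
    ∃ ℓ u, IsEnd r e ℓ u ∧ ((L.double r).arc (r + 1) e).hi = (L.double r).pos ℓ u := by
  simp only [arc, tail, double_head_of_lt (mem_oldEdges.mp he).1]
  rcases max_choice ((L.double r).pos e.1 e.2.1)
    ((L.double r).pos (e.1 + 1) (flip (r + 1) e.1 e.2.1 e.2.2)) with h | h
  · exact ⟨_, _, .inl ⟨rfl, rfl⟩, h⟩
  · exact ⟨_, _, .inr ⟨rfl, rfl⟩, h⟩

lemma IsEnd.bounds {e : ℕ × ℕ × Bool} (he : e ∈ oldEdges r) {ℓ u : ℕ} (h : IsEnd r e ℓ u) :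
    ℓ ≤ r ∧ u < 2 * 2 ^ r ∧ u % 2 = e.2.1 % 2 := by
  rw [mem_oldEdges] at he
  rcases h with ⟨rfl, rfl⟩ | ⟨rfl, rfl⟩
  · omega
  · have := flip_lt (r := r + 1) (i := e.1) (w := e.2.1) (by omega) (by rw [pow_succ]; omega) e.2.2
    rw [pow_succ] at this
    refine ⟨he.1, by omega, flip_succ_mod he.1 _ _⟩

lemma tail_project (e : ℕ × ℕ × Bool) (he : e ∈ oldEdges r) :
    L.tail (project e) = (L.double r).tail e / 4 := by
  rw [tail, tail, double_pos_div, Nat.mod_eq_of_lt (mem_oldEdges.mp he).1, project]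

lemma head_project (e : ℕ × ℕ × Bool) (he : e ∈ oldEdges r) :
    L.head r (project e) = (L.double r).head (r + 1) e / 4 := by
  have h := (mem_oldEdges.mp he).1
  rw [double_head_of_lt h, double_pos_div, flip_succ_div h, head, project]

namespace IsValid

variable (h : L.IsValid r)
include h

/-- Levels `0` and `r` share blocks but use different offsets. No conflict arises on one page: an
old edge ending at level `0` leaves it, one ending at level `r` comes from level `r - 1`, and these
lie on opposite pages. -/
lemma end_level_eq {e f : ℕ × ℕ × Bool} (he : e ∈ oldEdges r) (hf : f ∈ oldEdges r)
    {ℓ m u v : ℕ} (hu : IsEnd r e ℓ u) (hv : IsEnd r f m v) (h0 : ℓ = 0) (hm : m = r)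
    (hpage : ((L.double r).arc (r + 1) e).page = ((L.double r).arc (r + 1) f).page) : False := by
  rw [mem_oldEdges] at he hf
  have he0 : e.1 = 0 := by rcases hu with hu | hu <;> omega
  have hfr : f.1 = r - 1 := by rcases hv with hv | hv <;> omega
  have h1 := h.page_first (e.2.1 / 2) (by omega) e.2.2
  have h2 := h.page_last (f.2.1 / 2) (by omega) f.2.2
  rw [← he0] at h1
  rw [← hfr] at h2
  simp [arc, double, he.1, hf.1, h1, h2] at hpage

/-- Old edges keep the last bit of the row, so `bit` is the parity at either end. On one page a
common block forces a common level, where the parity fixes the offset. -/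
lemma bit_eq_iff_pos_eq {e f : ℕ × ℕ × Bool} (he : e ∈ oldEdges r) (hf : f ∈ oldEdges r)
    {ℓ m u v : ℕ} (hu : IsEnd r e ℓ u) (hv : IsEnd r f m v)
    (hpage : ((L.double r).arc (r + 1) e).page = ((L.double r).arc (r + 1) f).page)
    (hpos : (L.double r).pos ℓ u / 4 = (L.double r).pos m v / 4) :
    bit e = bit f ↔ (L.double r).pos ℓ u = (L.double r).pos m v := by
  obtain ⟨a1, a2, a3⟩ := hu.bounds he
  obtain ⟨b1, b2, b3⟩ := hv.bounds hf
  have hr : 0 < r := by rw [mem_oldEdges] at he; omega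
  rw [double_pos_div, double_pos_div] at hpos
  obtain ⟨c1, c2⟩ := h.inj _ (Nat.mod_lt _ hr) _ (Nat.mod_lt _ hr) _ (by omega) _ (by omega) hpos
  have hlm : ℓ = m := by
    rw [mod_of_le a1, mod_of_le b1] at c1
    have h1 : ¬ (ℓ = 0 ∧ m = r) := fun k => h.end_level_eq he hf hu hv k.1 k.2 hpage
    have h2 : ¬ (m = 0 ∧ ℓ = r) := fun k =>
      h.end_level_eq hf he hv hu k.1 k.2 hpage.symm
    split_ifs at c1 <;> omega
  subst hlm
  rw [bit_eq_iff, double_pos_eq_iff hpos, a3, b3]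

/-- The two copies appear in opposite orders at consecutive levels, and the blocks of the two ends
are distinct, so the arcs are nested. -/
lemma antiparallel {e f : ℕ × ℕ × Bool} (hr : 3 ≤ r) (he : e ∈ oldEdges r) (hf : f ∈ oldEdges r)
    (hef : project e = project f)
    (hlo : ((L.double r).arc (r + 1) e).lo < ((L.double r).arc (r + 1) f).lo) :
    ((L.double r).arc (r + 1) f).hi < ((L.double r).arc (r + 1) e).hi := by
  have he' := he
  have hf' := hf
  rw [mem_oldEdges] at he hf
  have hne := h.tail_ne_head hr (e := project e)
    (mem_edges.mpr ⟨he.1, by simp only [project]; omega⟩)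
  have t1 := tail_project (L := L) e he'
  have t2 := tail_project (L := L) f hf'
  have h1 := head_project (L := L) e he'
  have h2 := head_project (L := L) f hf'
  rw [← hef] at t2 h2
  obtain ⟨i, w, c⟩ := e
  obtain ⟨j, v, d⟩ := f
  simp only [project, Prod.mk.injEq] at hef
  obtain ⟨rfl, hwv, rfl⟩ := hef
  simp only [arc] at hlo ⊢
  generalize L.tail (project (i, w, c)) = p at *
  generalize L.head r (project (i, w, c)) = q at *
  rw [double_head_of_lt he.1] at *
  rw [double_head_of_lt hf.1] at *
  simp only [tail, double] at *
  have f1 := flip_succ_mod he.1 w c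
  have f2 := flip_succ_mod he.1 v c
  generalize flip (r + 1) i w c = w' at *
  generalize flip (r + 1) i v c = v' at *
  have : ¬ i = r := by omega
  have : ¬ i + 1 = 0 := by omega
  split_ifs at * <;> omega

lemma isDoubling (hr : 3 ≤ r) : IsDoubling project bit ((L.double r).arc (r + 1)) (L.arc r)
    (oldEdges r) (edges r) where
  mapsTo e he := by
    rw [mem_oldEdges] at he
    simp only [mem_edges, project]
    omega
  inj e he f hf hef hb := by
    rw [bit_eq_iff] at hb
    simp only [project, Prod.mk.injEq] at hef
    exact Prod.ext hef.1 (Prod.ext (by omega) hef.2.2)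
  page_eq e he := by simp [arc, double, project, (mem_oldEdges.mp he).1]
  lo_div e he := by
    have := tail_project (L := L) e he
    have := head_project (L := L) e he
    simp only [arc]
    omega
  hi_div e he := by
    have := tail_project (L := L) e he
    have := head_project (L := L) e he
    simp only [arc]
    omega
  lo_lo e he f hf hp hd := by
    obtain ⟨ℓ, u, hu, eu⟩ := exists_isEnd_lo (L := L) he
    obtain ⟨m, v, hv, ev⟩ := exists_isEnd_lo (L := L) hf
    rw [eu, ev] at hd ⊢
    exact h.bit_eq_iff_pos_eq he hf hu hv hp hd
  hi_hi e he f hf hp hd := by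
    obtain ⟨ℓ, u, hu, eu⟩ := exists_isEnd_hi (L := L) he
    obtain ⟨m, v, hv, ev⟩ := exists_isEnd_hi (L := L) hf
    rw [eu, ev] at hd ⊢
    exact h.bit_eq_iff_pos_eq he hf hu hv hp hd
  hi_lo e he f hf hp hd := by
    obtain ⟨ℓ, u, hu, eu⟩ := exists_isEnd_hi (L := L) he
    obtain ⟨m, v, hv, ev⟩ := exists_isEnd_lo (L := L) hf
    rw [eu, ev] at hd ⊢
    exact h.bit_eq_iff_pos_eq he hf hu hv hp hd
  anti e he f hf hef hlo := h.antiparallel hr he hf hef hlo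
  simple e he f hf := h.arc_simple hr he hf
  lo_lt_hi e he := h.lo_lt_hi hr he

lemma double (hr : 0 < r) : (L.double r).IsValid (r + 1) where
  inj i hi j hj w hw v hv hpos := by
    have hd := congrArg (· / 4) hpos
    rw [pow_succ] at hw hv
    simp only [double_pos_div] at hd
    obtain ⟨c1, c2⟩ := h.inj _ (Nat.mod_lt _ hr) _ (Nat.mod_lt _ hr) _ (by omega) _ (by omega) hd
    simp only [Layout.double, hd] at hpos
    rw [mod_of_le (by omega), mod_of_le (by omega)] at c1
    split_ifs at * <;> omega
  page_first w hw c := by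
    rw [pow_succ] at hw
    simp only [Layout.double, hr, if_true]
    exact h.page_first _ (by omega) c
  page_last w hw c := by simp [Layout.double]

end IsValid

end Layout
end WrappedButterfly

/-! ### The new edges, from level `r` to level `0` -/

namespace WrappedButterfly

namespace Layout

variable {L : Layout} {r : ℕ}

lemma double_tail_new {e : ℕ × ℕ × Bool} (hr : 0 < r) (he : e ∈ newEdges r) :
    (L.double r).tail e = 4 * L.pos 0 (e.2.1 / 2) + 2 * ((e.2.1 + r) % 2) := by
  simp [tail, double, (mem_newEdges.mp he).1, hr.ne']

lemma double_head_new {e : ℕ × ℕ × Bool} (he : e ∈ newEdges r) :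
    (L.double r).head (r + 1) e = 4 * L.pos 0 (e.2.1 / 2) + 1 +
      2 * (if e.2.2 then 1 - e.2.1 % 2 else e.2.1 % 2) := by
  rw [head, (mem_newEdges.mp he).1, Nat.mod_self]
  simp only [double, flip_last_div, Nat.zero_mod, if_true, Nat.add_zero, flip_last_mod]
  ring

lemma double_page_new {e : ℕ × ℕ × Bool} (he : e ∈ newEdges r) :
    ((L.double r).arc (r + 1) e).page = false := by
  simp [arc, double, (mem_newEdges.mp he).1]

namespace IsValid

variable (h : L.IsValid r)
include h

lemma level_ne_zero {f : ℕ × ℕ × Bool} (hf : f ∈ oldEdges r) {ℓ u : ℕ} (hu : IsEnd r f ℓ u)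
    (hp : ((L.double r).arc (r + 1) f).page = false) : ℓ ≠ 0 := by
  intro h0
  rw [mem_oldEdges] at hf
  have hf0 : f.1 = 0 := by rcases hu with hu | hu <;> omega
  have h1 := h.page_first (f.2.1 / 2) (by omega) f.2.2
  rw [← hf0] at h1
  simp [arc, Layout.double, hf.1, h1] at hp

/-- A crossing needs an end of `f` strictly inside the span of `e`, hence in its block. On the lower
page this end is at level `r`, with offset 0 or 2. Only offset 2 can be interior, and only to the
arc from 0 to 3. -/
lemma crosses_new_old {e f : ℕ × ℕ × Bool} (he : e ∈ newEdges r) (hf : f ∈ oldEdges r)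
    (hc : ((L.double r).arc (r + 1) e).Crosses ((L.double r).arc (r + 1) f) ∨
      ((L.double r).arc (r + 1) f).Crosses ((L.double r).arc (r + 1) e)) :
    f.1 + 1 = r ∧ flip r f.1 (f.2.1 / 2) f.2.2 = e.2.1 / 2 ∧ (f.2.1 + r) % 2 = 1 ∧
      (e.2.1 + r) % 2 = 0 ∧ (if e.2.2 then 1 - e.2.1 % 2 else e.2.1 % 2) = 1 := by
  have hr : 0 < r := by rw [mem_oldEdges] at hf; omega
  have hp := double_page_new (L := L) he
  have hpf : ((L.double r).arc (r + 1) f).page = false := by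
    rcases hc with hc | hc
    · rw [← hc.1, hp]
    · rw [hc.1, hp]
  have hend : ∃ ℓ u, IsEnd r f ℓ u ∧
      ((L.double r).arc (r + 1) e).lo < (L.double r).pos ℓ u ∧
      (L.double r).pos ℓ u < ((L.double r).arc (r + 1) e).hi := by
    rcases hc with ⟨-, h1, h2, -⟩ | ⟨-, -, h1, h2⟩
    · obtain ⟨ℓ, u, hu, eu⟩ := exists_isEnd_lo (L := L) hf
      exact ⟨ℓ, u, hu, eu ▸ h1, eu ▸ h2⟩
    · obtain ⟨ℓ, u, hu, eu⟩ := exists_isEnd_hi (L := L) hf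
      exact ⟨ℓ, u, hu, eu ▸ h1, eu ▸ h2⟩
  obtain ⟨ℓ, u, hu, h1, h2⟩ := hend
  obtain ⟨b1, b2, b3⟩ := hu.bounds hf
  have hℓ := h.level_ne_zero hf hu hpf
  simp only [arc, double_tail_new hr he, double_head_new he] at h1 h2
  have hy : (if e.2.2 then 1 - e.2.1 % 2 else e.2.1 % 2) ≤ 1 := by split_ifs <;> omega
  generalize (if e.2.2 then 1 - e.2.1 % 2 else e.2.1 % 2) = y at *
  have hd : (L.double r).pos ℓ u / 4 = L.pos 0 (e.2.1 / 2) := by omega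
  rw [double_pos_div] at hd
  have he' := (mem_newEdges.mp he).2
  obtain ⟨c1, c2⟩ := h.inj _ (Nat.mod_lt _ hr) _ hr _ (by omega) _ (by omega) hd
  rw [mod_of_le b1] at c1
  have hℓr : ℓ = r := by split_ifs at c1 <;> omega
  have hf' := mem_oldEdges.mp hf
  simp only [Layout.double, hℓr, hr.ne', if_true, if_false, Nat.mod_self] at h1 h2
  have hfr : f.1 + 1 = r ∧ u = flip (r + 1) f.1 f.2.1 f.2.2 := by
    rcases hu with hu | hu
    · omega
    · exact ⟨by omega, hu.2⟩
  refine ⟨hfr.1, ?_, ?_⟩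
  · rw [← flip_succ_div hf'.1, ← hfr.2, c2]
  · rw [c2] at h1 h2
    omega

/-- Each of the 2^r blocks has one arc from 0 to 3, and two old edges arrive at offset 2. -/
lemma card_crosses_new_old_le :
    (relPairs (fun a b => Arc.Crosses a b ∨ Arc.Crosses b a) ((L.double r).arc (r + 1))
      (newEdges r) (oldEdges r)).card ≤ 2 * 2 ^ r := by
  have hcard : (range (2 ^ r) ×ˢ (univ : Finset Bool)).card = 2 * 2 ^ r := by
    simp [mul_comm]
  rw [← hcard]
  refine card_le_card_of_injOn (fun x => (x.1.2.1 / 2, x.2.2.2)) ?_ ?_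
  · intro x hx
    have := (mem_newEdges.mp (mem_relPairs.mp hx).1.1).2
    simp only [coe_product, Set.mem_prod, mem_coe, mem_range, mem_univ, and_true]
    omega
  · rintro ⟨⟨i, w, c⟩, j, v, d⟩ hx ⟨⟨i', w', c'⟩, j', v', d'⟩ hy hxy
    obtain ⟨⟨he, hf⟩, hc⟩ := mem_relPairs.mp hx
    obtain ⟨⟨he', hf'⟩, hc'⟩ := mem_relPairs.mp hy
    obtain ⟨a1, a2, a3, a4, a5⟩ := h.crosses_new_old he hf hc
    obtain ⟨b1, b2, b3, b4, b5⟩ := h.crosses_new_old he' hf' hc'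
    have hi := (mem_newEdges.mp he).1
    have hi' := (mem_newEdges.mp he').1
    simp only [Prod.mk.injEq] at *
    obtain ⟨k1, rfl⟩ := hxy
    obtain rfl : j = j' := by omega
    have k2 := congrArg (flip r j · d) (a2.trans (k1.trans b2.symm))
    simp only [flip_flip] at k2
    have hcc : c = c' := by
      cases c <;> cases c' <;> simp at a5 b5 ⊢ <;> omega
    refine ⟨⟨by omega, by omega, hcc⟩, rfl, by omega, rfl⟩

lemma touches_new_old {e f : ℕ × ℕ × Bool} (he : e ∈ newEdges r) (hf : f ∈ oldEdges r)
    (hc : ((L.double r).arc (r + 1) e).Touches ((L.double r).arc (r + 1) f) ∨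
      ((L.double r).arc (r + 1) f).Touches ((L.double r).arc (r + 1) e)) :
    f.1 + 1 = r ∧ flip (r + 1) f.1 f.2.1 f.2.2 = e.2.1 := by
  have hr : 0 < r := by rw [mem_oldEdges] at hf; omega
  have hp := double_page_new (L := L) he
  have hpf : ((L.double r).arc (r + 1) f).page = false := by
    rcases hc with hc | hc
    · rw [← hc.1, hp]
    · rw [hc.1, hp]
  obtain ⟨ℓ₁, u₁, hu₁, eu₁⟩ := exists_isEnd_lo (L := L) hf
  obtain ⟨ℓ₂, u₂, hu₂, eu₂⟩ := exists_isEnd_hi (L := L) hf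
  have he' := mem_newEdges.mp he
  have hend : ∃ ℓ u, IsEnd r f ℓ u ∧
      ((L.double r).tail e = (L.double r).pos ℓ u ∨
        (L.double r).head (r + 1) e = (L.double r).pos ℓ u) := by
    have : (L.double r).tail e = (L.double r).pos ℓ₁ u₁ ∨
        (L.double r).head (r + 1) e = (L.double r).pos ℓ₁ u₁ ∨
        (L.double r).tail e = (L.double r).pos ℓ₂ u₂ ∨
        (L.double r).head (r + 1) e = (L.double r).pos ℓ₂ u₂ := by
      rw [← eu₁, ← eu₂]
      simp only [Arc.Touches] at hc
      have hlo : ((L.double r).arc (r + 1) e).lo =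
        min ((L.double r).tail e) ((L.double r).head (r + 1) e) := rfl
      have hhi : ((L.double r).arc (r + 1) e).hi =
        max ((L.double r).tail e) ((L.double r).head (r + 1) e) := rfl
      omega
    rcases this with k | k | k | k
    · exact ⟨_, _, hu₁, .inl k⟩
    · exact ⟨_, _, hu₁, .inr k⟩
    · exact ⟨_, _, hu₂, .inl k⟩
    · exact ⟨_, _, hu₂, .inr k⟩
  obtain ⟨ℓ, u, hu, hk⟩ := hend
  obtain ⟨b1, b2, b3⟩ := hu.bounds hf
  have hD := h.double hr
  have hℓ := h.level_ne_zero hf hu hpf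
  have hf' := mem_oldEdges.mp hf
  have hp2 : 2 ^ (r + 1) = 2 * 2 ^ r := by rw [pow_succ, mul_comm]
  rcases hk with hk | hk
  · obtain ⟨c1, c2⟩ := hD.inj _ (by omega) _ (by omega) _ (by omega) _ (by omega) hk
    rcases hu with hu | hu
    · omega
    · exact ⟨by omega, by rw [c2, hu.2]⟩
  · exact absurd (hD.inj _ (Nat.mod_lt _ (by omega)) _ (by omega) _
      (flip_lt (by omega) (by omega) _) _ (by omega) hk).1 (by
        rw [he'.1, Nat.mod_self]
        exact hℓ.symm)

/-- The common end is one of the 2·2^r vertices of level `r`, which has two old and two new edges.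
-/
lemma card_touches_new_old_le :
    (relPairs (fun a b => Arc.Touches a b ∨ Arc.Touches b a) ((L.double r).arc (r + 1))
      (newEdges r) (oldEdges r)).card ≤ 8 * 2 ^ r := by
  have hcard : (range (2 * 2 ^ r) ×ˢ (univ : Finset (Bool × Bool))).card = 8 * 2 ^ r := by
    simp
    ring
  rw [← hcard]
  refine card_le_card_of_injOn (fun x => (x.1.2.1, x.1.2.2, x.2.2.2)) ?_ ?_
  · intro x hx
    have := (mem_newEdges.mp (mem_relPairs.mp hx).1.1).2
    simpa using this
  · rintro ⟨⟨i, w, c⟩, j, v, d⟩ hx ⟨⟨i', w', c'⟩, j', v', d'⟩ hy hxy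
    obtain ⟨⟨he, hf⟩, hc⟩ := mem_relPairs.mp hx
    obtain ⟨⟨he', hf'⟩, hc'⟩ := mem_relPairs.mp hy
    obtain ⟨a1, a2⟩ := h.touches_new_old he hf hc
    obtain ⟨b1, b2⟩ := h.touches_new_old he' hf' hc'
    have hi := (mem_newEdges.mp he).1
    have hi' := (mem_newEdges.mp he').1
    simp only [Prod.mk.injEq] at *
    obtain ⟨rfl, rfl, rfl⟩ := hxy
    obtain rfl : j = j' := by omega
    have k2 := congrArg (flip (r + 1) j · d) (a2.trans b2.symm)
    simp only [flip_flip] at k2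
    exact ⟨⟨by omega, rfl, rfl⟩, rfl, k2, rfl⟩

omit h in
-- Within a block the arcs are 01, 03, 12 and 23, which do not interleave; different blocks are
-- disjoint.
lemma crosses_new_new_eq_empty (hr : 0 < r) :
    relPairs Arc.Crosses ((L.double r).arc (r + 1)) (newEdges r) (newEdges r) = ∅ := by
  refine eq_empty_of_forall_notMem fun x hx => ?_
  obtain ⟨⟨he, hf⟩, -, h1, h2, h3⟩ := mem_relPairs.mp hx
  simp only [arc, double_tail_new hr he, double_head_new he, double_tail_new hr hf,
    double_head_new hf] at h1 h2 h3
  split_ifs at h1 h2 h3 <;> omega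

omit h in
/-- The pairs of touching arcs among four arcs that join the ends at `0` and `2` of a block of
four positions to the ends at `1` and `3`. -/
lemma new_touch_cases {p q x₁ y₁ x₂ y₂ : ℕ} (hx₁ : x₁ ≤ 1) (hy₁ : y₁ ≤ 1) (hx₂ : x₂ ≤ 1)
    (hy₂ : y₂ ≤ 1)
    (h : min (4 * p + 2 * x₁) (4 * p + 1 + 2 * y₁) = min (4 * q + 2 * x₂) (4 * q + 1 + 2 * y₂) ∧
        max (4 * p + 2 * x₁) (4 * p + 1 + 2 * y₁) < max (4 * q + 2 * x₂) (4 * q + 1 + 2 * y₂) ∨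
      min (4 * p + 2 * x₁) (4 * p + 1 + 2 * y₁) < min (4 * q + 2 * x₂) (4 * q + 1 + 2 * y₂) ∧
        max (4 * p + 2 * x₁) (4 * p + 1 + 2 * y₁) = max (4 * q + 2 * x₂) (4 * q + 1 + 2 * y₂) ∨
      max (4 * p + 2 * x₁) (4 * p + 1 + 2 * y₁) = min (4 * q + 2 * x₂) (4 * q + 1 + 2 * y₂)) :
    p = q ∧ (x₁ = 0 ∧ y₁ = 0 ∧ x₂ = 0 ∧ y₂ = 1 ∨ x₁ = 0 ∧ y₁ = 1 ∧ x₂ = 1 ∧ y₂ = 1 ∨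
      x₁ = 1 ∧ y₁ = 0 ∧ x₂ = 1 ∧ y₂ = 1 ∨ x₁ = 0 ∧ y₁ = 0 ∧ x₂ = 1 ∧ y₂ = 0) := by
  interval_cases x₁ <;> interval_cases y₁ <;> interval_cases x₂ <;> interval_cases y₂ <;> omega

lemma card_touches_new_new_le (hr : 3 ≤ r) :
    (relPairs Arc.Touches ((L.double r).arc (r + 1)) (newEdges r) (newEdges r)).card ≤
      4 * 2 ^ r := by
  -- The four arcs of a block form a 4-cycle with touching pairs (01,03), (01,12), (12,23), (03,23).
  -- The offset of the right end of the first arc plus that of the left end of the second is 1, 2,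
  -- 4, 5 respectively, which tells them apart.
  have hcard : (range (2 ^ r) ×ˢ ({1, 2, 4, 5} : Finset ℕ)).card = 4 * 2 ^ r := by
    simp [mul_comm]
  have hr0 : 0 < r := by omega
  rw [← hcard]
  refine card_le_card_of_injOn (fun x => (x.1.2.1 / 2,
    ((L.double r).arc (r + 1) x.1).hi % 4 + ((L.double r).arc (r + 1) x.2).lo % 4)) ?_ ?_
  · intro x hx
    obtain ⟨⟨he, hf⟩, -, h1⟩ := mem_relPairs.mp hx
    have := (mem_newEdges.mp he).2
    simp only [coe_product, Set.mem_prod, mem_coe, mem_range, mem_insert, mem_singleton]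
    refine ⟨by omega, ?_⟩
    simp only [arc, double_tail_new hr0 he, double_head_new he, double_tail_new hr0 hf,
      double_head_new hf] at h1 ⊢
    split_ifs at h1 ⊢ <;> omega
  · rintro ⟨e, f⟩ hx ⟨e', f'⟩ hy hxy
    obtain ⟨⟨he, hf⟩, -, h1⟩ := mem_relPairs.mp hx
    obtain ⟨⟨he', hf'⟩, -, h2⟩ := mem_relPairs.mp hy
    simp only [Prod.mk.injEq] at hxy he hf he' hf' h1 h2 ⊢
    obtain ⟨k1, k2⟩ := hxy
    have hD := h.double hr0
    have hsub : ∀ {e}, e ∈ newEdges r → e ∈ edges (r + 1) := fun he => (mem_filter.mp he).1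
    have hkey : (((L.double r).arc (r + 1) e).lo = ((L.double r).arc (r + 1) e').lo ∧
        ((L.double r).arc (r + 1) e).hi = ((L.double r).arc (r + 1) e').hi) ∧
        ((L.double r).arc (r + 1) f).lo = ((L.double r).arc (r + 1) f').lo ∧
        ((L.double r).arc (r + 1) f).hi = ((L.double r).arc (r + 1) f').hi := by
      have hy : ∀ e : ℕ × ℕ × Bool, (if e.2.2 then 1 - e.2.1 % 2 else e.2.1 % 2) ≤ 1 := by
        intro e
        split_ifs <;> omega
      have y1 := hy e
      have y2 := hy f
      have y3 := hy e'
      have y4 := hy f'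
      simp only [arc, double_tail_new hr0 he, double_head_new he, double_tail_new hr0 hf,
        double_head_new hf, double_tail_new hr0 he', double_head_new he', double_tail_new hr0 hf',
        double_head_new hf', k1] at h1 h2 k2 ⊢
      generalize (if e.2.2 then 1 - e.2.1 % 2 else e.2.1 % 2) = y₁ at *
      generalize (if f.2.2 then 1 - f.2.1 % 2 else f.2.1 % 2) = y₂ at *
      generalize (if e'.2.2 then 1 - e'.2.1 % 2 else e'.2.1 % 2) = y₃ at *
      generalize (if f'.2.2 then 1 - f'.2.1 % 2 else f'.2.1 % 2) = y₄ at *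
      generalize L.pos 0 (e'.2.1 / 2) = p at *
      generalize L.pos 0 (f.2.1 / 2) = q at *
      generalize L.pos 0 (f'.2.1 / 2) = q' at *
      have := Nat.mod_lt (e.2.1 + r) (show 2 > 0 by norm_num)
      have := Nat.mod_lt (f.2.1 + r) (show 2 > 0 by norm_num)
      have := Nat.mod_lt (e'.2.1 + r) (show 2 > 0 by norm_num)
      have := Nat.mod_lt (f'.2.1 + r) (show 2 > 0 by norm_num)
      generalize (e.2.1 + r) % 2 = x₁ at *
      generalize (f.2.1 + r) % 2 = x₂ at *
      generalize (e'.2.1 + r) % 2 = x₃ at *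
      generalize (f'.2.1 + r) % 2 = x₄ at *
      obtain ⟨rfl, c1⟩ := new_touch_cases (by omega) y1 (by omega) y2 h1
      obtain ⟨rfl, c2⟩ := new_touch_cases (by omega) y3 (by omega) y4 h2
      clear h1 h2
      rcases c1 with ⟨rfl, rfl, rfl, rfl⟩ | ⟨rfl, rfl, rfl, rfl⟩ | ⟨rfl, rfl, rfl, rfl⟩ |
        ⟨rfl, rfl, rfl, rfl⟩ <;> rcases c2 with ⟨rfl, rfl, rfl, rfl⟩ | ⟨rfl, rfl, rfl, rfl⟩ |
        ⟨rfl, rfl, rfl, rfl⟩ | ⟨rfl, rfl, rfl, rfl⟩ <;> omega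
    exact ⟨hD.arc_simple (by omega) (hsub he) (hsub he') hkey.1.1 hkey.1.2,
      hD.arc_simple (by omega) (hsub hf) (hsub hf') hkey.2.1 hkey.2.2⟩

end IsValid

/-! ### The recursion for crossings and touching pairs -/

/-- The number of crossings of a layout. -/
def crossings (L : Layout) (r : ℕ) : ℕ := (relPairs Arc.Crosses (L.arc r) (edges r) (edges r)).card

/-- The number of pairs of touching arcs of a layout. -/
def touchings (L : Layout) (r : ℕ) : ℕ := (relPairs Arc.Touches (L.arc r) (edges r) (edges r)).card

theorem IsValid.crossings_double_le (h : L.IsValid r) (hr : 3 ≤ r) :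
    (L.double r).crossings (r + 1) ≤ 4 * L.crossings r + L.touchings r + 2 * 2 ^ r := by
  have h1 := card_relPairs_union_le Arc.Crosses ((L.double r).arc (r + 1)) (oldEdges r)
    (newEdges r) (fun _ _ _ _ h => h.asymm)
  have h2 := (h.isDoubling hr).card_crosses_le
  have h3 := h.card_crosses_new_old_le
  rw [oldEdges_union_newEdges, IsValid.crosses_new_new_eq_empty (by omega), card_empty] at h1
  simp only [crossings, touchings]
  omega

theorem IsValid.touchings_double_le (h : L.IsValid r) (hr : 3 ≤ r) :
    (L.double r).touchings (r + 1) ≤ 2 * L.touchings r + 12 * 2 ^ r := by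
  have hD := h.double (by omega)
  have h1 := card_relPairs_union_le Arc.Touches ((L.double r).arc (r + 1)) (oldEdges r)
    (newEdges r) (fun e he f hf h => h.asymm
      (hD.lo_lt_hi (by omega) (mem_filter.mp he).1) (hD.lo_lt_hi (by omega) (mem_filter.mp hf).1))
  have h2 := (h.isDoubling hr).card_touches_le
  have h3 := h.card_touches_new_old_le
  have h4 := h.card_touches_new_new_le hr
  rw [oldEdges_union_newEdges] at h1
  simp only [touchings]
  omega

end Layout
end WrappedButterfly

/-! ### From layouts to drawings of the wrapped butterfly -/

namespace WrappedButterfly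

/-- The number that encodes a row. -/
def encode {r : ℕ} (u : Fin r → Bool) : ℕ := Nat.ofBits fun i => u i.rev

lemma encode_lt {r : ℕ} (u : Fin r → Bool) : encode u < 2 ^ r := Nat.ofBits_lt_two_pow _

lemma testBit_encode {r : ℕ} (u : Fin r → Bool) (i : Fin r) :
    (encode u).testBit i = u i.rev := Nat.testBit_ofBits_lt _ _ i.2

lemma encode_injective {r : ℕ} : Function.Injective (encode (r := r)) := by
  intro u v h
  funext i
  have := testBit_encode u i.rev
  rw [h, testBit_encode] at this
  simpa using this.symm

lemma flip_encode {r : ℕ} {u v : Fin r → Bool} {i : Fin r} (h : ∀ b, u b ≠ v b ↔ b = i) :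
    flip r i (encode u) true = encode v := by
  apply Nat.eq_of_testBit_eq
  intro j
  simp only [flip, if_true, Nat.testBit_xor, Nat.testBit_two_pow]
  by_cases hj : j < r
  · have h1 := testBit_encode u ⟨j, hj⟩
    have h2 := testBit_encode v ⟨j, hj⟩
    simp only at h1 h2
    rw [h1, h2]
    have h3 := h (Fin.rev ⟨j, hj⟩)
    have h4 : Fin.rev ⟨j, hj⟩ = i ↔ r - 1 - (i : ℕ) = j := by
      rw [Fin.ext_iff, Fin.val_rev]
      have := i.2
      simp only
      omega
    rw [h4] at h3
    by_cases h5 : r - 1 - (i : ℕ) = j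
    · have := h3.mpr h5
      simp only [h5, decide_true, Bool.xor_true]
      exact (Bool.eq_not_of_ne this.symm).symm
    · have := mt h3.mp h5
      simp only [h5, decide_false, Bool.xor_false]
      exact not_not.mp this
  · have hle : 2 ^ r ≤ 2 ^ j := Nat.pow_le_pow_right (by norm_num) (by omega)
    rw [Nat.testBit_lt_two_pow ((encode_lt u).trans_le hle),
      Nat.testBit_lt_two_pow ((encode_lt v).trans_le hle)]
    have := i.2
    simp
    omega

namespace Layout

variable {L : Layout} {r : ℕ}

/-- The position of a vertex of the wrapped butterfly. -/
def vertexPos (L : Layout) (r : ℕ) (v : Fin r × (Fin r → Bool)) : ℕ := L.pos v.1 (encode v.2)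

lemma IsValid.vertexPos_injective (h : L.IsValid r) : Function.Injective (L.vertexPos r) := by
  intro u v huv
  obtain ⟨h1, h2⟩ := h.inj _ u.1.2 _ v.1.2 _ (encode_lt _) _ (encode_lt _) huv
  exact Prod.ext (Fin.ext h1) (encode_injective h2)

lemma exists_code (L : Layout) (e : Sym2 (Fin r × (Fin r → Bool)))
    (he : e ∈ (wrappedButterfly r).edgeSet) :
    ∃ x ∈ edges r, s(L.tail x, L.head r x) = e.map (L.vertexPos r) := by
  have key : ∀ u v : Fin r × (Fin r → Bool), (v.1 : ℕ) = ((u.1 : ℕ) + 1) % r →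
      (u.2 = v.2 ∨ ∀ b : Fin r, u.2 b ≠ v.2 b ↔ b = u.1) →
      ∃ x ∈ edges r, L.tail x = L.vertexPos r u ∧ L.head r x = L.vertexPos r v := by
    intro u v h1 h2
    rcases h2 with h2 | h2
    · exact ⟨(u.1, encode u.2, false), mem_edges.mpr ⟨u.1.2, encode_lt _⟩, rfl, by
        simp [head, vertexPos, flip, h1, h2]⟩
    · exact ⟨(u.1, encode u.2, true), mem_edges.mpr ⟨u.1.2, encode_lt _⟩, rfl, by
        simp only [head, vertexPos, flip_encode h2, h1]⟩
  induction e with | _ u v => ?_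
  obtain ⟨-, h | h⟩ := he
  · obtain ⟨x, hx, h1, h2⟩ := key u v h.1 h.2
    exact ⟨x, hx, by rw [h1, h2, Sym2.map_mk]⟩
  · obtain ⟨x, hx, h1, h2⟩ := key v u h.1 h.2
    exact ⟨x, hx, by rw [h1, h2, Sym2.map_mk, Sym2.eq_swap]⟩

/-- Each edge of the graph gets a code with the same two end positions. The code determines the
edge, so interleaving pairs of edges inject into crossing pairs of coded arcs. -/
theorem IsValid.crossingNumber_le (h : L.IsValid r) :
    (wrappedButterfly r).crossingNumber ≤ L.crossings r := by
  classical
  choose code hcode hs using L.exists_code (r := r)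
  let page : Sym2 (Fin r × (Fin r → Bool)) → Bool := fun e =>
    if he : e ∈ (wrappedButterfly r).edgeSet then (L.arc r (code e he)).page else false
  refine (SimpleGraph.BookDrawing.crossingNumber_le h.vertexPos_injective page).trans ?_
  have hlo : ∀ e : (wrappedButterfly r).edgeSet,
      SimpleGraph.BookDrawing.lo (L.vertexPos r) e = (L.arc r (code e e.2)).lo := fun e => by
    rw [SimpleGraph.BookDrawing.lo, ← hs e e.2, Sym2.inf_mk]
    rfl
  have hhi : ∀ e : (wrappedButterfly r).edgeSet,
      SimpleGraph.BookDrawing.hi (L.vertexPos r) e = (L.arc r (code e e.2)).hi := fun e => by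
    rw [SimpleGraph.BookDrawing.hi, ← hs e e.2, Sym2.sup_mk]
    rfl
  have hpage : ∀ e : (wrappedButterfly r).edgeSet, page e = (L.arc r (code e e.2)).page :=
    fun e => dif_pos e.2
  have hinj : Function.Injective fun e : (wrappedButterfly r).edgeSet => code e e.2 := by
    intro e f hef
    apply Subtype.ext
    apply Sym2.map.injective h.vertexPos_injective
    rw [← hs e e.2, ← hs f f.2, show code e e.2 = code f f.2 from hef]
  rw [← (hinj.prodMap hinj).injOn.encard_image, crossings, ← Set.encard_coe_eq_coe_finsetCard]
  apply Set.encard_le_encard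
  rintro _ ⟨⟨e, f⟩, hef, rfl⟩
  refine mem_relPairs.mpr ⟨⟨hcode e e.2, hcode f f.2⟩, ?_⟩
  obtain ⟨h0, h1, h2, h3⟩ := hef
  rw [hpage, hpage] at h0
  rw [hlo, hlo] at h1
  rw [hlo, hhi] at h2
  rw [hhi, hhi] at h3
  exact ⟨h0, h1, h2, h3⟩

end Layout

/-! ### The base layout in dimension 4 and the induction -/

/-- The positions of the vertices in `Layout.four`, level by level. -/
def fourPositions : List ℕ :=
  [63, 50, 56, 55, 0, 44, 7, 40, 17, 31, 23, 24, 14, 32, 8, 39,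
   62, 49, 57, 54, 1, 47, 6, 41, 16, 30, 22, 25, 15, 33, 9, 38,
   61, 48, 58, 53, 2, 46, 5, 42, 19, 29, 21, 26, 12, 34, 10, 37,
   60, 51, 59, 52, 3, 45, 4, 43, 18, 28, 20, 27, 13, 35, 11, 36]

/-- A layout of the wrapped butterfly of dimension `4` with few crossings. -/
def Layout.four : Layout where
  pos i w := fourPositions.getD (16 * i + w) 0
  -- The 64-bit mask stores the pages of the edges out of levels 1 and 2, 32 per level; levels 0 and
  -- 3 are forced by `IsValid`.
  page i w c := i == 0 || i != 3 && Nat.testBit 0xfbaff6afa0a8a4a2 (32 * (i - 1) + 2 * w + c.toNat)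

namespace Layout

lemma four_isValid : four.IsValid 4 where
  inj i hi j hj w hw v hv h := by
    have hnodup : fourPositions.Nodup := by decide +kernel
    have hlen : fourPositions.length = 64 := rfl
    have h1 : 16 * i + w < fourPositions.length := by omega
    have h2 : 16 * j + v < fourPositions.length := by omega
    simp only [four, List.getD_eq_getElem _ _ h1, List.getD_eq_getElem _ _ h2] at h
    have := hnodup.getElem_inj_iff.mp h
    omega
  page_first := by decide +kernel
  page_last := by decide +kernel

lemma four_crossings : four.crossings 4 = 83 := by decide +kernel

lemma four_touchings : four.touchings 4 = 150 := by decide +kernel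

/-- In every dimension from `4` on there is a layout with few crossings. -/
theorem exists_isValid (k : ℕ) : ∃ L : Layout, L.IsValid (k + 4) ∧
    (L.crossings (k + 4) : ℝ) ≤ 111 / 128 * 4 ^ (k + 4) - (3 * (k + 4) - 53 / 16) * 2 ^ (k + 4) ∧
    (L.touchings (k + 4) : ℝ) ≤ (6 * (k + 4) - 117 / 8) * 2 ^ (k + 4) := by
  -- With r = k + 4, the two bounds solve c' = 4c + t + 2·2^r and t' = 2t + 12·2^r exactly, with c =
  -- 83 and t = 150 at r = 4.
  induction k with
  | zero =>
    refine ⟨four, four_isValid, ?_, ?_⟩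
    · rw [zero_add, four_crossings]
      norm_num
    · rw [zero_add, four_touchings]
      norm_num
  | succ k ih =>
    obtain ⟨L, h, h1, h2⟩ := ih
    have h3 : ((L.double (k + 4)).crossings (k + 4 + 1) : ℝ) ≤
        4 * L.crossings (k + 4) + L.touchings (k + 4) + 2 * 2 ^ (k + 4) := by
      exact_mod_cast h.crossings_double_le (by omega)
    have h4 : ((L.double (k + 4)).touchings (k + 4 + 1) : ℝ) ≤
        2 * L.touchings (k + 4) + 12 * 2 ^ (k + 4) := by
      exact_mod_cast h.touchings_double_le (by omega)
    rw [show k + 1 + 4 = k + 4 + 1 by ring]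
    refine ⟨L.double (k + 4), h.double (by omega), ?_, ?_⟩
    · rw [pow_succ (4 : ℝ) (k + 4), pow_succ (2 : ℝ) (k + 4)]
      push_cast
      linarith
    · rw [pow_succ (2 : ℝ) (k + 4)]
      push_cast
      linarith

end Layout
end WrappedButterfly

theorem theorem4 (r : ℕ) (hr : 6 ≤ r) :
    ∃ n : ℕ, (wrappedButterfly r).crossingNumber = (n : ℕ∞) ∧
      (n : ℝ) ≤ 7 / 8 * (4 : ℝ) ^ r - (3 * (r : ℝ) - 4) * (2 : ℝ) ^ r := by
  obtain ⟨k, rfl⟩ : ∃ k, r = k + 4 := ⟨r - 4, by omega⟩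
  obtain ⟨L, h, h1, -⟩ := WrappedButterfly.Layout.exists_isValid k
  have hle := h.crossingNumber_le
  obtain ⟨n, hn⟩ := ENat.ne_top_iff_exists.mp (ne_top_of_le_ne_top (ENat.natCast_ne_top _) hle)
  refine ⟨n, hn.symm, ?_⟩
  have hnL : (n : ℝ) ≤ L.crossings (k + 4) := by
    rw [← hn] at hle
    exact_mod_cast hle
  have h4 : (0 : ℝ) < 4 ^ (k + 4) := by positivity
  have h2 : (0 : ℝ) < 2 ^ (k + 4) := by positivity
  push_cast
  -- With r = k + 4, the bound for the layout lies below the required one by 4^r/128 + (11/16)·2^r.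
  nlinarith
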